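/- Consider scheduling with explorable uncertainty on $m\ge 1$ identical parallel machines. There are $n$ jobs; job $j$ has a testing time $t_j\ge 0$, an upper limit $u_j$, and a real processing time $p_j\in[0,u_j]$. A job is either executed untested, which takes $u_j$ time units, or it is first tested, which takes $t_j$ time units, and at some later time (possibly on another machine) executed, which takes $p_j$ time units. Each task (test, execution, or untested execution) runs without interruption on one machine, a machine processes one task at a time, and all jobs are available at time $0$. A deterministic online algorithm knows all $t_j,u_j$ from the beginning, but learns $p_j$ only when the test of $j$ is finished. The objective is the sum of the completion times of the jobs, where a job is completed when its execution (tested or untested) is finished. An algorithm is $c$-competitive if on every instance its cost is at most $c$ times the cost of every feasible offline schedule (which may depend on all $p_j$). Let $\phi=\frac{1+\sqrt5}{2}$, $\alpha=\phi$ and $\beta=\frac{1+\sqrt5+\sqrt{2(7+5\sqrt5)}}{4}$. A list schedule follows the rule $\mathrm{PCP}_{\alpha,\beta}$ if job $j$ is tested exactly when $u_j\ge\alpha t_j$; the tasks are weighted by $\beta t_j$ (test), $t_j+p_j$ (execution after a test) and $u_j$ (untested execution), where tests and untested executions are available from time $0$ and the execution of a tested job from the end of its test; no machine is idle while an available task is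 waiting; and a task that is started at time $s$ has weight at most that of every task that is available at time $s$ and is started later. Theorem. For every $m\ge1$ there is a deterministic online algorithm on $m$ parallel machines which always produces a list schedule following $\mathrm{PCP}_{\alpha,\beta}$ and which is $$\Bigl(2.31652\bigl(\tfrac12+\tfrac1{2m}\bigr)+\phi\bigl(1-\tfrac1m\bigr)\Bigr)\text{-competitive}$$ for the total completion time. As $m\to\infty$ this ratio tends to $\frac{2.31652}{2}+\phi$, which lies strictly between $2.77629$ and $2.77630$. -/

import Mathlib

namespace SEU

/-- An instance of scheduling with explorable uncertainty with `n` jobs. Job `j` has a known testing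
time `t j`, a known upper limit `u j`, and a real processing time `p j ∈ [0, u j]`, which an online
algorithm learns only when the test of `j` is completed. -/
structure Instance (n : ℕ) where
  t : Fin n → ℝ
  u : Fin n → ℝ
  p : Fin n → ℝ
  t_nonneg : ∀ j, 0 ≤ t j
  p_nonneg : ∀ j, 0 ≤ p j
  p_le_u : ∀ j, p j ≤ u j

/-- The tasks regarding a job: testing it, executing it after its test, executing it untested. -/
inductive Task (n : ℕ) where
  | test (j : Fin n) : Task n
  | exec (j : Fin n) : Task n
  | untested (j : Fin n) : Task n

/-- The time needed by a task. -/
def Instance.duration {n : ℕ} (I : Instance n) : Task n → ℝ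
  | .test j => I.t j
  | .exec j => I.p j
  | .untested j => I.u j

/-- The decision to start `task` on `machine` at time `start`; it then runs without interruption. -/
structure Placement (n m : ℕ) where
  task : Task n
  machine : Fin m
  start : ℝ

/-- The time at which a placed task is finished. -/
def Placement.finish {n m : ℕ} (I : Instance n) (d : Placement n m) : ℝ :=
  d.start + I.duration d.task

/-- A schedule on `m` machines is the list of its placements. -/
abbrev Schedule (n m : ℕ) := List (Placement n m)

/-- The task `x` is part of the schedule `S`. -/
def Schedule.Has {n m : ℕ} (S : Schedule n m) (x : Task n) : Prop :=
  ∃ d ∈ S, d.task = x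

/-- Feasibility: no task is done twice; each job is either executed untested, or tested and then
executed (possibly later and on another machine), but not both; the execution of a tested job
does not start before its test is finished; a machine processes one task at a time. -/
structure Schedule.IsFeasible {n m : ℕ} (I : Instance n) (S : Schedule n m) : Prop where
  start_nonneg : ∀ d ∈ S, 0 ≤ d.start
  nodup : (S.map Placement.task).Nodup
  complete : ∀ j : Fin n,
    (S.Has (.untested j) ∧ ¬ S.Has (.test j) ∧ ¬ S.Has (.exec j)) ∨
    (¬ S.Has (.untested j) ∧ S.Has (.test j) ∧ S.Has (.exec j))
  precedence : ∀ a ∈ S, ∀ b ∈ S, ∀ j : Fin n,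
    a.task = .test j → b.task = .exec j → a.finish I ≤ b.start
  machine : ∀ a ∈ S, ∀ b ∈ S, a.task ≠ b.task → a.machine = b.machine →
    a.finish I ≤ b.start ∨ b.finish I ≤ a.start

/-- The completion time of a job that a placement contributes to the objective: a job is completed
when its execution (tested or untested) is finished; a test completes no job. -/
def Placement.completion {n m : ℕ} (I : Instance n) (d : Placement n m) : ℝ :=
  match d.task with
  | .test _ => 0
  | .exec _ => d.finish I
  | .untested _ => d.finish I

/-- The total completion time of all jobs. -/
def Schedule.cost {n m : ℕ} (I : Instance n) (S : Schedule n m) : ℝ :=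
  (S.map (Placement.completion I)).sum

/-- A deterministic online algorithm for `m` parallel machines. It takes its decisions one after
the other in the order of time. A decision taken at time `s` depends only on the testing times and
upper limits, and on the real processing times of those jobs whose test was started by an
earlier decision and is finished by time `s`: if two instances agree on these data, the
algorithm takes the same decisions up to and including this one. -/
structure OnlineAlgorithm (m : ℕ) where
  run : ∀ {n : ℕ}, Instance n → Schedule n m
  feasible : ∀ {n : ℕ} (I : Instance n), (run I).IsFeasible I
  chronological : ∀ {n : ℕ} (I : Instance n),
    (run I).Pairwise (fun a b => a.start ≤ b.start)
  causal : ∀ {n : ℕ} (I J : Instance n), I.t = J.t → I.u = J.u →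
    ∀ (k : ℕ) (hk : k < (run I).length),
      (∀ d ∈ (run I).take k, ∀ j : Fin n,
        d.task = .test j → d.finish I ≤ (run I)[k].start → I.p j = J.p j) →
      (run I).take (k + 1) <+: run J

/-- `A` is `c`-competitive for the total completion time: its cost is at most `c` times the cost
of every feasible (offline) schedule, hence at most `c` times the optimal cost. -/
def OnlineAlgorithm.IsCompetitive {m : ℕ} (A : OnlineAlgorithm m) (c : ℝ) : Prop :=
  ∀ (n : ℕ) (I : Instance n) (S : Schedule n m), S.IsFeasible I →
    (A.run I).cost I ≤ c * S.cost I

/-- The priority-queue weights of PCP: `β * t j` for a test, the total time `t j + p j` for the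
execution of a tested job, `u j` for an untested execution. -/
def Instance.weight {n : ℕ} (I : Instance n) (β : ℝ) : Task n → ℝ
  | .test j => β * I.t j
  | .exec j => I.t j + I.p j
  | .untested j => I.u j

/-- In the schedule `S`, the task `x` is in the queue from its release on: tests and untested
executions are available from time `0`, the execution of a tested job once its test is finished. -/
def Schedule.Released {n m : ℕ} (I : Instance n) (S : Schedule n m) (x : Task n) (τ : ℝ) : Prop :=
  match x with
  | .test _ => 0 ≤ τ
  | .exec j => ∃ d ∈ S, d.task = .test j ∧ d.finish I ≤ τ
  | .untested _ => 0 ≤ τ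

/-- `S` is a list schedule of the algorithm `PCP_{α,β}` (Prioritizing-Certain-Processing-time): job
`j` is tested iff `u j ≥ α * t j`; a task that is started has smallest weight among
the tasks waiting in the queue; no machine is idle while a task is waiting. -/
structure Schedule.IsPCP {n m : ℕ} (I : Instance n) (α β : ℝ) (S : Schedule n m) : Prop where
  tests : ∀ j : Fin n, S.Has (.test j) ↔ α * I.t j ≤ I.u j
  priority : ∀ a ∈ S, ∀ b ∈ S, a.start < b.start → S.Released I b.task a.start →
    I.weight β a.task ≤ I.weight β b.task
  busy : ∀ b ∈ S, ∀ τ : ℝ, τ < b.start → S.Released I b.task τ →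
    ∀ i : Fin m, ∃ a ∈ S, a.machine = i ∧ a.start ≤ τ ∧ τ < a.finish I

/-- The parameter `β` used with `α = φ`. -/
noncomputable def pcpBeta : ℝ :=
  (1 + Real.sqrt 5 + Real.sqrt (2 * (7 + 5 * Real.sqrt 5))) / 4

/-- The competitive ratio on `m` machines. -/
noncomputable def ratio (m : ℕ) : ℝ :=
  2.31652 * (1 / 2 + 1 / (2 * (m : ℝ))) + Real.goldenRatio * (1 - 1 / (m : ℝ))

end SEU

namespace SEU

/-! ### Constants, the fractional shortest-processing-time bound, and inequalities on intervals. -/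

section

open Finset

/-! Let ρ_j = min(u_j, t_j + p_j) be the least time that any schedule spends on j, and M = ∑_{i,j}
min(ρ_i, ρ_j). Both costs are compared with M and ∑ρ.

Offline: packing the intervals on each machine and Cauchy–Schwarz over the machines give (∑ L_j)² ≤
2m ∑ L_j (C_j − L_j/2) for every set of jobs. Abel summation over the jobs sorted by length turns
these inequalities into M + m ∑ρ ≤ 2m · cost. Also ∑ρ ≤ cost.

Online: all machines are busy while j waits, so m (C_j − time spent on j) is at most the total
length of the tasks of other jobs that start before a cut κ_j. The time spent on j is at most φ ρ_j.
Delays are charged in pairs: i and j together delay each other by at most β min(ρ_i, ρ_j)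
(`delay_add_delay_le`), where β² = φ(β + 1) balances the critical case. Hence 2m · cost ≤ 2mφ ∑ρ + β
(M − ∑ρ).

The difficulty peculiar to several machines is that a heavy task, started while j is being tested,
might delay the execution of j. `Schedule.IsPCP.weight_le_of_waiting` excludes this: otherwise m + 1
tasks would be running at the start of the last such heavy task.

The schedule itself is built greedily: earliest possible start first, then smallest weight. Only
weights of tasks available at the moment of decision are compared, which makes the rule online. -/

theorem pcpBeta_eq : pcpBeta ^ 2 = Real.goldenRatio * (pcpBeta + 1) := by
  have h5 : Real.sqrt 5 ^ 2 = 5 := Real.sq_sqrt (by norm_num)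
  have hs : Real.sqrt (2 * (7 + 5 * Real.sqrt 5)) ^ 2 = 2 * (7 + 5 * Real.sqrt 5) :=
    Real.sq_sqrt (by positivity)
  unfold pcpBeta Real.goldenRatio
  generalize Real.sqrt (2 * (7 + 5 * Real.sqrt 5)) = y at *
  generalize Real.sqrt 5 = x at *
  linear_combination (1 / 16) * hs - (1 / 16) * h5

theorem sqrt_five_bounds : 2.2360679 < Real.sqrt 5 ∧ Real.sqrt 5 < 2.236068 :=
  ⟨Real.lt_sqrt_of_sq_lt (by norm_num), (Real.sqrt_lt' (by norm_num)).2 (by norm_num)⟩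

theorem goldenRatio_bounds : 1.61803395 < Real.goldenRatio ∧ Real.goldenRatio < 1.618034 := by
  have h := sqrt_five_bounds
  unfold Real.goldenRatio
  constructor <;> linarith [h.1, h.2]

theorem pcpBeta_bounds : 2.316 < pcpBeta ∧ pcpBeta ≤ 2.31652 := by
  have h := sqrt_five_bounds
  have h1 : 6.0295 < Real.sqrt (2 * (7 + 5 * Real.sqrt 5)) :=
    Real.lt_sqrt_of_sq_lt (by norm_num; linarith [h.1])
  have h2 : Real.sqrt (2 * (7 + 5 * Real.sqrt 5)) < 6.03 :=
    (Real.sqrt_lt' (by norm_num)).2 (by norm_num; linarith [h.2])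
  unfold pcpBeta
  constructor <;> linarith [h.1, h.2]

theorem tendsto_ratio :
    Filter.Tendsto ratio Filter.atTop (nhds (2.31652 / 2 + Real.goldenRatio)) := by
  have h := tendsto_one_div_atTop_nhds_zero_nat (𝕜 := ℝ)
  have h2 := ((h.const_mul (1 / 2)).const_add (1 / 2)).const_mul (2.31652 : ℝ) |>.add
    ((h.const_sub 1).const_mul Real.goldenRatio)
  convert h2 using 2
  · rename_i m
    unfold ratio
    congr 3
    rw [one_div_mul_one_div]
  · ring

/-- If the mean busy times `N` satisfy the parallel inequality `c (∑ L)² ≤ ∑ L N` on every set of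
jobs, then their sum is at least that of the fractional shortest-processing-time schedule. -/
theorem sum_min_le_of_parallel {ι : Type*} [DecidableEq ι] (L N : ι → ℝ) (c : ℝ)
    (hL : ∀ i, 0 ≤ L i) (hN : ∀ i, 0 ≤ N i) (A : Finset ι)
    (h : ∀ B ⊆ A, c * (∑ i ∈ B, L i) ^ 2 ≤ ∑ i ∈ B, L i * N i) :
    c * ∑ i ∈ A, ∑ j ∈ A, min (L i) (L j) ≤ ∑ i ∈ A, N i := by
  -- Abel summation, arranged as an induction that adds a longest job. The upper bound `x` on the
  -- lengths is left free, so that the induction hypothesis can be used with the length of the new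
  -- job.
  have key : ∀ x, 0 < x → (∀ i ∈ A, L i ≤ x) →
      ∑ i ∈ A, L i * N i - c * (∑ i ∈ A, L i) ^ 2 ≤
        x * (∑ i ∈ A, N i - c * ∑ i ∈ A, ∑ j ∈ A, min (L i) (L j)) := by
    induction A using Finset.induction_on_max_value L with
    | empty => intro x _ _; simp
    | @insert k B hk hmax ih =>
      intro x hx hle
      have ih' := ih fun D hD => h D (hD.trans (subset_insert _ _))
      have hmin : ∑ i ∈ insert k B, ∑ j ∈ insert k B, min (L i) (L j) =
          ∑ i ∈ B, ∑ j ∈ B, min (L i) (L j) + 2 * ∑ i ∈ B, L i + L k := by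
        have h1 : ∑ j ∈ B, min (L k) (L j) = ∑ j ∈ B, L j :=
          sum_congr rfl fun j hj => min_eq_right (hmax j hj)
        have h2 : ∑ j ∈ B, min (L j) (L k) = ∑ j ∈ B, L j :=
          sum_congr rfl fun j hj => min_eq_left (hmax j hj)
        simp only [sum_insert hk, sum_add_distrib, h1, h2, min_self]
        ring
      have hG := h _ subset_rfl
      rw [hmin]
      rw [sum_insert hk, sum_insert hk] at hG ⊢
      rw [sum_insert hk]
      rcases (hL k).eq_or_lt with h0 | hpos
      · have hz : ∀ i ∈ B, L i = 0 := fun i hi => le_antisymm (h0 ▸ hmax i hi) (hL i)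
        have e1 : ∑ i ∈ B, L i = 0 := sum_eq_zero hz
        have e2 : ∑ i ∈ B, L i * N i = 0 := sum_eq_zero fun i hi => by rw [hz i hi, zero_mul]
        have e3 : ∑ i ∈ B, ∑ j ∈ B, min (L i) (L j) = 0 :=
          sum_eq_zero fun i hi => sum_eq_zero fun j hj => by rw [hz i hi, hz j hj, min_self]
        rw [e1, e2, e3, ← h0]
        have : 0 ≤ N k + ∑ i ∈ B, N i := add_nonneg (hN k) (sum_nonneg fun i _ => hN i)
        have := mul_nonneg hx.le this
        linarith
      · have h1 := ih' (L k) hpos hmax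
        have h2 : (L k * N k + ∑ i ∈ B, L i * N i) - c * (L k + ∑ i ∈ B, L i) ^ 2 ≤
            L k * (N k + ∑ i ∈ B, N i -
              c * (∑ i ∈ B, ∑ j ∈ B, min (L i) (L j) + 2 * ∑ i ∈ B, L i + L k)) := by
          linarith
        -- The parallel inequality makes the left side of `h2` nonnegative. So the bracket is
        -- nonnegative and its factor `L k` may be raised to `x`.
        have h3 : 0 ≤ N k + ∑ i ∈ B, N i -
              c * (∑ i ∈ B, ∑ j ∈ B, min (L i) (L j) + 2 * ∑ i ∈ B, L i + L k) := by
          by_contra hneg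
          have := mul_neg_of_pos_of_neg hpos (not_le.1 hneg)
          linarith
        exact h2.trans (mul_le_mul_of_nonneg_right (hle k (mem_insert_self _ _)) h3)
  have hx : ∀ i ∈ A, L i ≤ 1 + ∑ i ∈ A, L i := fun i hi => by
    have := single_le_sum (fun i _ => hL i) hi
    linarith
  have hpos : 0 < 1 + ∑ i ∈ A, L i := by
    have := sum_nonneg fun i (_ : i ∈ A) => hL i
    linarith
  have h1 := key _ hpos hx
  have h2 := h A subset_rfl
  by_contra hneg
  have := mul_neg_of_pos_of_neg hpos (sub_neg.2 (not_le.1 hneg))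
  linarith

/-- Disjoint intervals in `[0, ∞)`: their total length is at most the last finish, and their
length-weighted midpoints are at least those of a contiguous packing. -/
theorem sum_mul_midpoint_of_disjoint {ι : Type*} [DecidableEq ι] (s d : ι → ℝ) (Q : Finset ι)
    (hs : ∀ a ∈ Q, 0 ≤ s a) (hd : ∀ a ∈ Q, 0 ≤ d a)
    (hdis : ∀ a ∈ Q, ∀ b ∈ Q, a ≠ b → s a + d a ≤ s b ∨ s b + d b ≤ s a) :
    (∀ x, 0 ≤ x → (∀ a ∈ Q, s a + d a ≤ x) → ∑ a ∈ Q, d a ≤ x) ∧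
      (∑ a ∈ Q, d a) ^ 2 / 2 ≤ ∑ a ∈ Q, d a * (s a + d a / 2) := by
  induction Q using Finset.induction_on_max_value s with
  | empty => simp
  | @insert b B hb hmax ih =>
    obtain ⟨ih1, ih2⟩ := ih (fun a ha => hs a (mem_insert_of_mem ha))
      (fun a ha => hd a (mem_insert_of_mem ha))
      (fun a ha c hc => hdis a (mem_insert_of_mem ha) c (mem_insert_of_mem hc))
    have hsb := hs b (mem_insert_self _ _)
    rw [sum_insert hb, sum_insert hb]
    -- Only an interval of positive length forces the others to end before it; one of length 0 may
    -- share its start with a longer one, but contributes nothing.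
    rcases (hd b (mem_insert_self _ _)).eq_or_lt with h0 | hpos
    · rw [← h0]
      refine ⟨fun x hx h => ?_, by simpa using ih2⟩
      simpa using ih1 x hx fun a ha => h a (mem_insert_of_mem ha)
    · have hfin : ∀ a ∈ B, s a + d a ≤ s b := fun a ha => by
        rcases hdis a (mem_insert_of_mem ha) b (mem_insert_self _ _)
          (fun h => hb (h ▸ ha)) with h | h
        · exact h
        · linarith [hmax a ha]
      have h1 := ih1 (s b) hsb hfin
      refine ⟨fun x _ h => by linarith [h b (mem_insert_self _ _)], ?_⟩
      have := mul_le_mul_of_nonneg_left h1 hpos.le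
      nlinarith

/-- Finitely many intervals that cover `[0, x)` have total length at least `x`. -/
theorem le_sum_of_cover {ι : Type*} (s d : ι → ℝ) (Q : Finset ι) (x : ℝ)
    (hd : ∀ a ∈ Q, 0 ≤ d a)
    (hcov : ∀ τ, 0 ≤ τ → τ < x → ∃ a ∈ Q, s a ≤ τ ∧ τ < s a + d a) :
    x ≤ ∑ a ∈ Q, d a := by
  have h1 : Set.Ico 0 x ⊆ ⋃ a ∈ Q, Set.Ico (s a) (s a + d a) := fun τ hτ => by
    obtain ⟨a, ha, h⟩ := hcov τ hτ.1 hτ.2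
    exact Set.mem_biUnion ha h
  have h2 := (MeasureTheory.measure_mono (μ := MeasureTheory.volume) h1).trans
    (MeasureTheory.measure_biUnion_finset_le Q _)
  simp only [Real.volume_Ico, sub_zero, add_sub_cancel_left] at h2
  rw [← ENNReal.ofReal_sum_of_nonneg hd] at h2
  exact (ENNReal.ofReal_le_ofReal_iff (sum_nonneg hd)).1 h2

end

/-! ### The lower bound on offline schedules. -/

section

open Finset
open scoped Classical

/-- The job that a task belongs to. -/
def Task.job {n : ℕ} : Task n → Fin n
  | .test j => j
  | .exec j => j
  | .untested j => j

theorem Instance.u_nonneg {n : ℕ} (I : Instance n) (j : Fin n) : 0 ≤ I.u j :=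
  (I.p_nonneg j).trans (I.p_le_u j)

theorem Instance.duration_nonneg {n : ℕ} (I : Instance n) (x : Task n) : 0 ≤ I.duration x := by
  cases x with
  | test j => exact I.t_nonneg j
  | exec j => exact I.p_nonneg j
  | untested j => exact I.u_nonneg j

theorem Placement.start_le_finish {n m : ℕ} (I : Instance n) (d : Placement n m) :
    d.start ≤ d.finish I := le_add_of_nonneg_right (I.duration_nonneg _)

/-- The least time that an offline schedule spends on job `j`. -/
noncomputable def Instance.offline {n : ℕ} (I : Instance n) (j : Fin n) : ℝ :=
  min (I.u j) (I.t j + I.p j)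

theorem Instance.offline_nonneg {n : ℕ} (I : Instance n) (j : Fin n) : 0 ≤ I.offline j :=
  le_min (I.u_nonneg j) (add_nonneg (I.t_nonneg j) (I.p_nonneg j))

/-- The placements of the tasks of job `j`. -/
noncomputable def Schedule.part {n m : ℕ} (S : Schedule n m) (j : Fin n) :
    Finset (Placement n m) :=
  S.toFinset.filter fun d => d.task.job = j

/-- The completion time of job `j`. -/
noncomputable def Schedule.jobCompletion {n m : ℕ} (I : Instance n) (S : Schedule n m)
    (j : Fin n) : ℝ :=
  ∑ d ∈ S.part j, d.completion I

/-- The processing time spent on job `j`. -/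
noncomputable def Schedule.jobTime {n m : ℕ} (I : Instance n) (S : Schedule n m)
    (j : Fin n) : ℝ :=
  ∑ d ∈ S.part j, I.duration d.task

section

variable {n m : ℕ} {I : Instance n} {S : Schedule n m}

theorem Schedule.IsFeasible.eq_of_task_eq (h : S.IsFeasible I) {a b : Placement n m}
    (ha : a ∈ S) (hb : b ∈ S) (hab : a.task = b.task) : a = b :=
  List.inj_on_of_nodup_map h.nodup ha hb hab

theorem Schedule.sum_part (S : Schedule n m) (f : Placement n m → ℝ) (A : Finset (Fin n)) :
    ∑ j ∈ A, ∑ d ∈ S.part j, f d = ∑ d ∈ S.toFinset.filter (fun d => d.task.job ∈ A), f d := by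
  rw [← sum_fiberwise_of_maps_to (g := fun d : Placement n m => d.task.job) (t := A)
    (fun d hd => (mem_filter.1 hd).2)]
  refine sum_congr rfl fun j hj => sum_congr ?_ fun _ _ => rfl
  ext d
  simp only [Schedule.part, mem_filter]
  constructor
  · rintro ⟨h1, h2⟩
    exact ⟨⟨h1, h2 ▸ hj⟩, h2⟩
  · rintro ⟨⟨h1, _⟩, h2⟩
    exact ⟨h1, h2⟩

theorem Schedule.IsFeasible.cost_eq (h : S.IsFeasible I) :
    S.cost I = ∑ j, S.jobCompletion I j := by
  unfold Schedule.jobCompletion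
  rw [Schedule.sum_part]
  simp only [mem_univ, filter_true]
  rw [List.sum_toFinset _ (List.Nodup.of_map _ h.nodup)]
  rfl

/-- A job is either executed untested or tested and then executed. -/
theorem Schedule.IsFeasible.part_cases (h : S.IsFeasible I) (j : Fin n) :
    (∃ b ∈ S, b.task = .untested j ∧ S.part j = {b}) ∨
    (∃ a ∈ S, ∃ b ∈ S, a.task = .test j ∧ b.task = .exec j ∧ a ≠ b ∧ S.part j = {a, b}) := by
  rcases h.complete j with ⟨⟨b, hb, hbt⟩, h1, h2⟩ | ⟨h1, ⟨a, ha, hat⟩, ⟨b, hb, hbt⟩⟩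
  · refine Or.inl ⟨b, hb, hbt, ?_⟩
    ext d
    simp only [Schedule.part, mem_filter, List.mem_toFinset, mem_singleton]
    constructor
    · rintro ⟨hd, hj⟩
      rcases hdt : d.task with k | k | k <;> rw [hdt] at hj <;> obtain rfl : k = j := hj
      · exact (h1 ⟨d, hd, hdt⟩).elim
      · exact (h2 ⟨d, hd, hdt⟩).elim
      · exact h.eq_of_task_eq hd hb (hdt.trans hbt.symm)
    · rintro rfl
      exact ⟨hb, by rw [hbt]; rfl⟩
  · refine Or.inr ⟨a, ha, b, hb, hat, hbt, fun hab => ?_, ?_⟩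
    · rw [hab, hbt] at hat
      cases hat
    ext d
    simp only [Schedule.part, mem_filter, List.mem_toFinset, mem_singleton, mem_insert]
    constructor
    · rintro ⟨hd, hj⟩
      rcases hdt : d.task with k | k | k <;> rw [hdt] at hj <;> obtain rfl : k = j := hj
      · exact Or.inl (h.eq_of_task_eq hd ha (hdt.trans hat.symm))
      · exact Or.inr (h.eq_of_task_eq hd hb (hdt.trans hbt.symm))
      · exact (h1 ⟨d, hd, hdt⟩).elim
    · rintro (rfl | rfl)
      · exact ⟨ha, by rw [hat]; rfl⟩
      · exact ⟨hb, by rw [hbt]; rfl⟩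

theorem Schedule.IsFeasible.offline_le_jobTime (h : S.IsFeasible I) (j : Fin n) :
    I.offline j ≤ S.jobTime I j := by
  unfold Schedule.jobTime Instance.offline
  rcases h.part_cases j with ⟨b, _, hbt, hp⟩ | ⟨a, _, b, _, hat, hbt, hab, hp⟩
  · rw [hp, sum_singleton, hbt]
    exact min_le_left _ _
  · rw [hp, sum_pair hab, hat, hbt]
    exact min_le_right _ _

theorem Schedule.IsFeasible.jobTime_le_jobCompletion (h : S.IsFeasible I) (j : Fin n) :
    S.jobTime I j ≤ S.jobCompletion I j := by
  unfold Schedule.jobTime Schedule.jobCompletion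
  rcases h.part_cases j with ⟨b, hb, hbt, hp⟩ | ⟨a, ha, b, hb, hat, hbt, hab, hp⟩
  · have := h.start_nonneg b hb
    simp only [hp, sum_singleton, hbt, Placement.completion, Placement.finish]
    linarith
  · have h1 := h.start_nonneg a ha
    have h2 := h.precedence a ha b hb j hat hbt
    simp only [Placement.finish, hat] at h2
    simp only [hp, sum_pair hab, hat, hbt, Placement.completion, Placement.finish]
    linarith

/-- The length-weighted midpoints of the tasks of a job, against its completion time. -/
theorem Schedule.IsFeasible.sum_part_midpoint_le (h : S.IsFeasible I) (j : Fin n) :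
    ∑ d ∈ S.part j, I.duration d.task * (d.start + I.duration d.task / 2) ≤
      S.jobTime I j * (S.jobCompletion I j - S.jobTime I j / 2) := by
  unfold Schedule.jobTime Schedule.jobCompletion
  rcases h.part_cases j with ⟨b, hb, hbt, hp⟩ | ⟨a, ha, b, hb, hat, hbt, hab, hp⟩
  · simp only [hp, sum_singleton, hbt, Placement.completion, Placement.finish]
    exact le_of_eq (by ring)
  -- Postponing the test until it ends at the start of the execution only increases the left side,
  -- and then both sides agree.
  · have h2 := h.precedence a ha b hb j hat hbt
    simp only [Placement.finish, hat] at h2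
    simp only [hp, sum_pair hab, hat, hbt, Placement.completion, Placement.finish]
    have h0 : 0 ≤ I.duration (.test j) := I.duration_nonneg _
    have := mul_le_mul_of_nonneg_left h2 h0
    nlinarith

/-- The parallel inequality on `m` machines for a set of jobs. -/
theorem Schedule.IsFeasible.parallel (h : S.IsFeasible I) (A : Finset (Fin n)) :
    (∑ j ∈ A, S.jobTime I j) ^ 2 ≤
      2 * m * ∑ j ∈ A, S.jobTime I j * (S.jobCompletion I j - S.jobTime I j / 2) := by
  set P := S.toFinset.filter fun d => d.task.job ∈ A
  have hP : ∀ d ∈ P, d ∈ S := fun d hd => List.mem_toFinset.1 (mem_filter.1 hd).1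
  have h1 : ∑ d ∈ P, I.duration d.task * (d.start + I.duration d.task / 2) ≤
      ∑ j ∈ A, S.jobTime I j * (S.jobCompletion I j - S.jobTime I j / 2) := by
    rw [← Schedule.sum_part]
    exact sum_le_sum fun j _ => h.sum_part_midpoint_le j
  have h2 : ∑ j ∈ A, S.jobTime I j = ∑ d ∈ P, I.duration d.task := Schedule.sum_part _ _ _
  have h3 : ∀ k : Fin m, (∑ d ∈ P with d.machine = k, I.duration d.task) ^ 2 / 2 ≤
      ∑ d ∈ P with d.machine = k, I.duration d.task * (d.start + I.duration d.task / 2) :=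
    fun k => (sum_mul_midpoint_of_disjoint (fun d : Placement n m => d.start)
      (fun d => I.duration d.task) _
      (fun a ha => h.start_nonneg a (hP a (mem_filter.1 ha).1))
      (fun a _ => I.duration_nonneg _)
      (fun a ha b hb hab => h.machine a (hP a (mem_filter.1 ha).1) b (hP b (mem_filter.1 hb).1)
        (fun e => hab (h.eq_of_task_eq (hP a (mem_filter.1 ha).1) (hP b (mem_filter.1 hb).1) e))
        ((mem_filter.1 ha).2.trans (mem_filter.1 hb).2.symm))).2
  have h4 := sum_le_sum fun k (_ : k ∈ univ) => h3 k
  rw [sum_fiberwise, ← sum_div] at h4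
  -- Cauchy–Schwarz over the machines is the source of the factor m.
  have h5 := sq_sum_le_card_mul_sum_sq (s := (univ : Finset (Fin m)))
    (f := fun k => ∑ d ∈ P with d.machine = k, I.duration d.task)
  rw [sum_fiberwise, card_univ, Fintype.card_fin] at h5
  rw [h2]
  have h6 : (0 : ℝ) ≤ m := Nat.cast_nonneg m
  have := mul_le_mul_of_nonneg_left (h4.trans h1) h6
  linarith

/-- The lower bound of Eastman, Even and Isaacs for the cost of an offline schedule, multiplied by
`2 m`. -/
theorem Schedule.IsFeasible.sum_min_le_cost (h : S.IsFeasible I) (hm : 0 < m) :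
    ∑ i, ∑ j, min (I.offline i) (I.offline j) + m * ∑ j, I.offline j ≤ 2 * m * S.cost I := by
  have hm' : (0 : ℝ) < m := Nat.cast_pos.2 hm
  have hL : ∀ j, 0 ≤ S.jobTime I j := fun j => (I.offline_nonneg j).trans (h.offline_le_jobTime j)
  -- C_j − L_j/2 is the mean busy time of j if it were processed in one piece ending at C_j.
  have h1 := sum_min_le_of_parallel (S.jobTime I)
    (fun j => S.jobCompletion I j - S.jobTime I j / 2) (1 / (2 * m)) hL
    (fun j => by linarith [hL j, h.jobTime_le_jobCompletion j]) univ
    (fun B _ => by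
      rw [one_div_mul_eq_div, div_le_iff₀ (by positivity)]
      linarith [h.parallel B])
  rw [one_div_mul_eq_div, div_le_iff₀ (by positivity), sum_sub_distrib, ← sum_div,
    ← h.cost_eq] at h1
  have h2 : ∑ i, ∑ j, min (I.offline i) (I.offline j) ≤
      ∑ i, ∑ j, min (S.jobTime I i) (S.jobTime I j) :=
    sum_le_sum fun i _ => sum_le_sum fun j _ =>
      min_le_min (h.offline_le_jobTime i) (h.offline_le_jobTime j)
  have h3 : ∑ j, I.offline j ≤ ∑ j, S.jobTime I j :=
    sum_le_sum fun j _ => h.offline_le_jobTime j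
  have := mul_le_mul_of_nonneg_left h3 hm'.le
  linarith

theorem Schedule.IsFeasible.sum_offline_le_cost (h : S.IsFeasible I) :
    ∑ j, I.offline j ≤ S.cost I := by
  rw [h.cost_eq]
  exact sum_le_sum fun j _ => (h.offline_le_jobTime j).trans (h.jobTime_le_jobCompletion j)

end

end

/-! ### How much two jobs delay each other. -/

section

open Finset
open scoped Classical

section

variable {φ β : ℝ}

/-- Since x ≤ w/β, the sum is at most (1 + 1/β) w ≤ (1 + 1/β) φ ρ = β ρ. This is the balance that
determines β. -/
theorem add_le_mul_of_mul_le (hβ : 0 < β) (h : β ^ 2 = φ * (β + 1)) {x w ρ : ℝ}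
    (h1 : β * x ≤ w) (h2 : w ≤ φ * ρ) : x + w ≤ β * ρ := by
  have h3 : (β + 1) * w ≤ (β + 1) * (φ * ρ) := mul_le_mul_of_nonneg_left h2 (by linarith)
  refine le_of_mul_le_mul_left (a := β) ?_ hβ
  calc β * (x + w) ≤ (β + 1) * w := by linarith
    _ ≤ (β + 1) * (φ * ρ) := h3
    _ = β * (β * ρ) := by linear_combination -ρ * h

/-- Two untested jobs delay each other by at most `β ρ₁`. -/
theorem untested_untested_delay_le (hβ : 0 ≤ β) (hφβ : φ ≤ β) {r₁ r₂ u₁ u₂ ρ₁ : ℝ} (hρ : 0 ≤ ρ₁)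
    (hu : u₁ ≤ φ * ρ₁) (h : r₂ < r₁ → u₂ ≤ u₁) :
    (if r₂ < r₁ then u₂ else 0) + (if r₁ < r₂ then u₁ else 0) ≤ β * ρ₁ := by
  have := mul_le_mul_of_nonneg_right hφβ hρ
  have := mul_nonneg hβ hρ
  split_ifs with h1 h2 h2
  · linarith
  · linarith [h h1]
  · linarith
  · linarith

/-- A tested and an untested job delay each other by at most `β ρ`, for either job. -/
theorem tested_untested_delay_le (hφβ : φ ≤ β) (hβ2 : 2 ≤ β)
    (h : β ^ 2 = φ * (β + 1))
    {s₁ e₁ κ₁ t₁ p₁ r₂ u₂ ρ₁ ρ₂ : ℝ} (ht : 0 ≤ t₁) (hp : 0 ≤ p₁) (hρ₁ : 0 ≤ ρ₁) (hρ₂ : 0 ≤ ρ₂)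
    (hu : u₂ ≤ φ * ρ₂) (h_u0 : 0 ≤ u₂) (htρ : t₁ ≤ ρ₁)
    (http : 2 * t₁ + p₁ ≤ β * ρ₁)
    (hse : s₁ ≤ e₁) (hκ : κ₁ ≤ e₁)
    (ha : r₂ < s₁ → u₂ ≤ β * t₁) (hb : s₁ ≤ r₂ → r₂ < κ₁ → u₂ ≤ t₁ + p₁)
    (hc : s₁ < r₂ → β * t₁ ≤ u₂) (hd : e₁ < r₂ → t₁ + p₁ ≤ u₂) :
    (if r₂ < κ₁ then u₂ else 0) + ((if s₁ < r₂ then t₁ else 0) + (if e₁ < r₂ then p₁ else 0))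
        ≤ β * ρ₁ ∧
      (if r₂ < κ₁ then u₂ else 0) + ((if s₁ < r₂ then t₁ else 0) + (if e₁ < r₂ then p₁ else 0))
        ≤ β * ρ₂ := by
  have h1 := mul_le_mul_of_nonneg_right hφβ hρ₁
  have h2 := mul_le_mul_of_nonneg_right hφβ hρ₂
  have hβ : 0 < β := by linarith
  have h3 := mul_le_mul_of_nonneg_left htρ hβ.le
  have h4 : t₁ ≤ β * t₁ := le_mul_of_one_le_left ht (by linarith)
  by_cases c1 : r₂ < κ₁
  · have c3 : ¬ e₁ < r₂ := by linarith
    rw [if_pos c1, if_neg c3]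
    by_cases c2 : s₁ < r₂
    -- The untested task starts between the test and the execution of the other job. Then t₁ + u₂ ≤
    -- 2 t₁ + p₁ ≤ β ρ₁, while β t₁ ≤ u₂ ≤ φ ρ₂ gives the bound by β ρ₂.
    · have h5 := hc c2
      have h6 := hb c2.le c1
      have h7 := add_le_mul_of_mul_le hβ h h5 hu
      rw [if_pos c2]
      constructor <;> linarith
    · rw [if_neg c2]
      have h7 : u₂ ≤ β * t₁ ∨ u₂ ≤ t₁ + p₁ := by
        rcases lt_or_ge r₂ s₁ with h8 | h8
        · exact Or.inl (ha h8)
        · exact Or.inr (hb h8 c1)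
      rcases h7 with h7 | h7 <;> constructor <;> linarith
  · rw [if_neg c1]
    by_cases c2 : s₁ < r₂
    · have h5 := hc c2
      rw [if_pos c2]
      by_cases c3 : e₁ < r₂
      · have h6 := hd c3
        rw [if_pos c3]
        constructor <;> linarith
      · rw [if_neg c3]
        constructor <;> linarith
    · have c3 : ¬ e₁ < r₂ := by linarith
      rw [if_neg c2, if_neg c3]
      have := mul_nonneg hβ.le hρ₁
      have := mul_nonneg hβ.le hρ₂
      constructor <;> linarith

/-- Two tested jobs delay each other by at most `β ρ₁`. -/
theorem tested_tested_delay_le (hφβ : φ ≤ β) (hβ2 : 2 ≤ β)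
    (h : β ^ 2 = φ * (β + 1))
    {s₁ e₁ κ₁ t₁ p₁ s₂ e₂ κ₂ t₂ p₂ ρ₁ : ℝ} (hρ₁ : 0 ≤ ρ₁)
    (ht₁ : 0 ≤ t₁) (hp₁ : 0 ≤ p₁) (htρ : t₁ ≤ ρ₁) (htp : t₁ + p₁ ≤ φ * ρ₁)
    (http : 2 * t₁ + p₁ ≤ β * ρ₁)
    (hse₁ : s₁ ≤ e₁) (hse₂ : s₂ ≤ e₂) (hκ₁ : κ₁ = s₁ ∨ κ₁ = e₁) (hκ₂ : κ₂ = s₂ ∨ κ₂ = e₂)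
    (a1 : s₂ < s₁ → β * t₂ ≤ β * t₁) (a2 : e₂ < s₁ → t₂ + p₂ ≤ β * t₁)
    (a3 : s₁ ≤ s₂ → s₂ < κ₁ → β * t₂ ≤ t₁ + p₁) (a4 : s₁ ≤ e₂ → e₂ < κ₁ → t₂ + p₂ ≤ t₁ + p₁) :
    ((if s₂ < κ₁ then t₂ else 0) + (if e₂ < κ₁ then p₂ else 0)) +
      ((if s₁ < κ₂ then t₁ else 0) + (if e₁ < κ₂ then p₁ else 0)) ≤ β * ρ₁ := by
  have hβ : 0 < β := by linarith
  have h1 := mul_le_mul_of_nonneg_right hφβ hρ₁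
  have h2 := mul_le_mul_of_nonneg_left htρ hβ.le
  have h3 : 2 * t₁ ≤ β * t₁ := mul_le_mul_of_nonneg_right hβ2 ht₁
  have hκ₁' : κ₁ ≤ e₁ := by rcases hκ₁ with h | h <;> linarith
  have hκ₂' : κ₂ ≤ e₂ := by rcases hκ₂ with h | h <;> linarith
  -- the delay of the first job by the test of the second
  have key : s₂ < κ₁ → t₂ + (t₁ + p₁) ≤ β * ρ₁ := fun hs => by
    rcases lt_or_ge s₂ s₁ with h5 | h5
    · have := le_of_mul_le_mul_left (a1 h5) hβ
      linarith
    · exact add_le_mul_of_mul_le hβ h (a3 h5 hs) htp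
  by_cases c1 : s₂ < κ₁
  · have h4 := key c1
    by_cases c2 : e₂ < κ₁
    -- Both tasks of the second job count, so κ₂ ≤ e₂ < κ₁ ≤ e₁, and the execution of the first does
    -- not count.
    · have c4 : ¬ e₁ < κ₂ := by linarith
      rw [if_pos c1, if_pos c2, if_neg c4]
      by_cases c3 : s₁ < κ₂
      · rw [if_pos c3]
        rcases lt_or_ge e₂ s₁ with h5 | h5
        · linarith
        · have := a4 h5 c2
          linarith
      · rw [if_neg c3]
        rcases lt_or_ge e₂ s₁ with h5 | h5
        · linarith [a2 h5]
        · have := a4 h5 c2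
          linarith
    · rw [if_pos c1, if_neg c2]
      split_ifs <;> linarith
  · have c2 : ¬ e₂ < κ₁ := by linarith
    rw [if_neg c1, if_neg c2]
    split_ifs <;> linarith

end

section

variable {n : ℕ} {I : Instance n}

/-- If ρ = u, use p ≤ u and t ≤ u/φ, with 1 + 1/φ = φ for the second bound. If ρ = t + p, it
suffices that φ ≥ 1 and β ≥ 2. -/
theorem Instance.tested_bounds {j : Fin n} (h : Real.goldenRatio * I.t j ≤ I.u j) :
    I.t j ≤ I.offline j ∧ I.t j + I.p j ≤ Real.goldenRatio * I.offline j ∧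
      2 * I.t j + I.p j ≤ pcpBeta * I.offline j := by
  have hφ := goldenRatio_bounds
  have hβ := pcpBeta_bounds
  have hsq := Real.goldenRatio_sq
  have ht := I.t_nonneg j
  have hp := I.p_nonneg j
  have hpu := I.p_le_u j
  have hu := I.u_nonneg j
  unfold Instance.offline
  generalize Real.goldenRatio = φ at *
  generalize pcpBeta = β at *
  -- A crude 1.6 in place of φ suffices: 2/1.6 + 1 = 2.25 < β.
  have h16 : 1.6 * I.t j ≤ I.u j :=
    (mul_le_mul_of_nonneg_right (by linarith [hφ.1]) ht).trans h
  refine ⟨le_min (by linarith) (by linarith), ?_, ?_⟩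
  · rw [mul_min_of_nonneg _ _ (by linarith)]
    refine le_min ?_ (le_mul_of_one_le_left (by linarith) (by linarith))
    refine le_of_mul_le_mul_left (a := φ) ?_ (by linarith)
    have := mul_le_mul_of_nonneg_left hpu (show 0 ≤ φ by linarith)
    calc φ * (I.t j + I.p j) ≤ I.u j + φ * I.u j := by linarith
      _ = φ * (φ * I.u j) := by linear_combination -(I.u j) * hsq
  · rw [mul_min_of_nonneg _ _ (by linarith)]
    have h1 := mul_le_mul_of_nonneg_right hβ.1.le hu
    have h2 := mul_le_mul_of_nonneg_right hβ.1.le (add_nonneg ht hp)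
    refine le_min ?_ ?_ <;> linarith

theorem Instance.untested_bound {j : Fin n} (h : I.u j < Real.goldenRatio * I.t j) :
    I.u j ≤ Real.goldenRatio * I.offline j := by
  have hφ := goldenRatio_bounds.1
  unfold Instance.offline
  rw [mul_min_of_nonneg _ _ (by linarith)]
  refine le_min (le_mul_of_one_le_left (I.u_nonneg j) (by linarith)) ?_
  have := mul_nonneg (show 0 ≤ Real.goldenRatio by linarith) (I.p_nonneg j)
  linarith

end

section

variable {n m : ℕ} {I : Instance n} {S : Schedule n m}

/-- The facts on the untested job `j` that is delayed only by tasks started before `κ`. -/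
structure UntestedProfile (I : Instance n) (S : Schedule n m) (j : Fin n) (κ : ℝ)
    (b : Placement n m) : Prop where
  mem : b ∈ S
  task : b.task = .untested j
  part : S.part j = {b}
  cut : κ = b.start
  bound : I.u j ≤ Real.goldenRatio * I.offline j
  before : ∀ d ∈ S, d.start < κ → I.weight pcpBeta d.task ≤ I.u j

/-- The facts on the tested job `j` that is delayed only by tasks started before `κ`. -/
structure TestedProfile (I : Instance n) (S : Schedule n m) (j : Fin n) (κ : ℝ)
    (a b : Placement n m) : Prop where
  mem_test : a ∈ S
  mem_exec : b ∈ S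
  test : a.task = .test j
  exec : b.task = .exec j
  ne : a ≠ b
  part : S.part j = {a, b}
  cut : κ = a.start ∨ κ = b.start
  le : a.start ≤ b.start
  bounds : I.t j ≤ I.offline j ∧ I.t j + I.p j ≤ Real.goldenRatio * I.offline j ∧
      2 * I.t j + I.p j ≤ pcpBeta * I.offline j
  before_test : ∀ d ∈ S, d.start < a.start → I.weight pcpBeta d.task ≤ pcpBeta * I.t j
  between : ∀ d ∈ S, a.start ≤ d.start → d.start < κ →
    I.weight pcpBeta d.task ≤ I.t j + I.p j

/-- Job `j` is delayed only by tasks started before `κ`. -/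
def HasProfile (I : Instance n) (S : Schedule n m) (j : Fin n) (κ : ℝ) : Prop :=
  (∃ b, UntestedProfile I S j κ b) ∨ ∃ a b, TestedProfile I S j κ a b

/-- The time spent on job `j` by tasks that start before `κ`. -/
noncomputable def Schedule.delay (I : Instance n) (S : Schedule n m) (κ : ℝ) (j : Fin n) : ℝ :=
  ∑ d ∈ S.part j, if d.start < κ then I.duration d.task else 0

/-- Four cases, according to which of the two jobs are tested; the profiles supply the priority
comparisons. The smaller offline time is reached by bounding the sum against either job separately.
-/
theorem delay_add_delay_le {i j : Fin n} {κ₁ κ₂ : ℝ}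
    (h₁ : HasProfile I S i κ₁) (h₂ : HasProfile I S j κ₂) :
    S.delay I κ₁ j + S.delay I κ₂ i ≤ pcpBeta * min (I.offline i) (I.offline j) := by
  have hφ := goldenRatio_bounds
  have hβ := pcpBeta_bounds
  have hβ0 : 0 ≤ pcpBeta := by linarith
  have hφβ : Real.goldenRatio ≤ pcpBeta := by linarith
  have hβ2 : 2 ≤ pcpBeta := by linarith
  have hsq := pcpBeta_eq
  have hρ₁ := I.offline_nonneg i
  have hρ₂ := I.offline_nonneg j
  rw [mul_min_of_nonneg _ _ (by linarith)]
  unfold Schedule.delay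
  rcases h₁ with ⟨b, h₁⟩ | ⟨a, b, h₁⟩ <;> rcases h₂ with ⟨d, h₂⟩ | ⟨c, d, h₂⟩
  · simp only [h₁.part, h₂.part, sum_singleton, h₁.task, h₂.task, Instance.duration]
    have e1 := h₁.before d h₂.mem
    have e2 := h₂.before b h₁.mem
    rw [h₁.task] at e2
    rw [h₂.task] at e1
    rw [h₁.cut] at e1 ⊢
    rw [h₂.cut] at e2 ⊢
    refine le_min (untested_untested_delay_le hβ0 hφβ hρ₁ h₁.bound e1) ?_
    rw [add_comm]
    exact untested_untested_delay_le hβ0 hφβ hρ₂ h₂.bound e2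
  · have hcut : κ₂ ≤ d.start := by rcases h₂.cut with h | h <;> linarith [h₂.le]
    have e1 := h₁.before c h₂.mem_test
    have e2 := h₁.before d h₂.mem_exec
    have e3 := h₂.before_test b h₁.mem
    have e4 := h₂.between b h₁.mem
    simp only [h₁.part, h₂.part, sum_singleton, sum_pair h₂.ne, h₁.task, h₂.test, h₂.exec,
      h₁.cut, Instance.duration, Instance.weight] at e1 e2 e3 e4 ⊢
    have := tested_untested_delay_le hφβ hβ2 hsq (I.t_nonneg j) (I.p_nonneg j) hρ₂ hρ₁
      h₁.bound (I.u_nonneg i) h₂.bounds.1 h₂.bounds.2.2 h₂.le hcut e3 e4 e1 e2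
    rw [add_comm]
    exact le_min this.2 this.1
  · have hcut : κ₁ ≤ b.start := by rcases h₁.cut with h | h <;> linarith [h₁.le]
    have e1 := h₂.before a h₁.mem_test
    have e2 := h₂.before b h₁.mem_exec
    have e3 := h₁.before_test d h₂.mem
    have e4 := h₁.between d h₂.mem
    simp only [h₁.part, h₂.part, sum_singleton, sum_pair h₁.ne, h₂.task, h₁.test, h₁.exec,
      h₂.cut, Instance.duration, Instance.weight] at e1 e2 e3 e4 ⊢
    have := tested_untested_delay_le hφβ hβ2 hsq (I.t_nonneg i) (I.p_nonneg i) hρ₁ hρ₂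
      h₂.bound (I.u_nonneg j) h₁.bounds.1 h₁.bounds.2.2 h₁.le hcut e3 e4 e1 e2
    exact le_min this.1 this.2
  · have e1 := h₁.before_test c h₂.mem_test
    have e2 := h₁.before_test d h₂.mem_exec
    have e3 := h₁.between c h₂.mem_test
    have e4 := h₁.between d h₂.mem_exec
    have f1 := h₂.before_test a h₁.mem_test
    have f2 := h₂.before_test b h₁.mem_exec
    have f3 := h₂.between a h₁.mem_test
    have f4 := h₂.between b h₁.mem_exec
    simp only [h₁.part, h₂.part, sum_pair h₁.ne, sum_pair h₂.ne, h₁.test, h₁.exec, h₂.test,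
      h₂.exec, Instance.duration, Instance.weight] at e1 e2 e3 e4 f1 f2 f3 f4 ⊢
    refine le_min ?_ ?_
    · exact tested_tested_delay_le hφβ hβ2 hsq hρ₁ (I.t_nonneg i) (I.p_nonneg i) h₁.bounds.1
        h₁.bounds.2.1 h₁.bounds.2.2 h₁.le h₂.le h₁.cut h₂.cut
        e1 e2 e3 e4
    · rw [add_comm]
      exact tested_tested_delay_le hφβ hβ2 hsq hρ₂ (I.t_nonneg j) (I.p_nonneg j) h₂.bounds.1
        h₂.bounds.2.1 h₂.bounds.2.2 h₂.le h₁.le h₂.cut h₁.cut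
        f1 f2 f3 f4

end

end

/-! ### Total delay and cost of a list schedule. -/

section

open Finset
open scoped Classical

section

variable {n m : ℕ} {I : Instance n} {S : Schedule n m}

theorem Schedule.mem_part {j : Fin n} {d : Placement n m} :
    d ∈ S.part j ↔ d ∈ S ∧ d.task.job = j := by
  simp [Schedule.part]

/-- Two placements on the same machine that are both running at some time are equal. -/
theorem Schedule.IsFeasible.eq_of_running (h : S.IsFeasible I) {a b : Placement n m} {τ : ℝ}
    (ha : a ∈ S) (hb : b ∈ S) (hm : a.machine = b.machine) (ha1 : a.start ≤ τ)
    (ha2 : τ < a.finish I) (hb1 : b.start ≤ τ) (hb2 : τ < b.finish I) : a = b := by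
  by_contra hne
  rcases h.machine a ha b hb (fun e => hne (h.eq_of_task_eq ha hb e)) hm with h1 | h1 <;> linarith

/-- If the execution of a tested job has to wait after its test, then no task with a
larger weight than this execution is started in the meantime. -/
theorem Schedule.IsPCP.weight_le_of_waiting {α β : ℝ} (hP : S.IsPCP I α β) (hF : S.IsFeasible I)
    {j : Fin n} {a b : Placement n m} (ha : a ∈ S) (hb : b ∈ S) (hat : a.task = .test j)
    (hbt : b.task = .exec j) (hwait : a.finish I < b.start) {d : Placement n m} (hd : d ∈ S)
    (hd1 : a.start ≤ d.start) (hd2 : d.start < b.start) :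
    I.weight β d.task ≤ I.weight β b.task := by
  have hrel : ∀ τ, a.finish I ≤ τ → S.Released I b.task τ := fun τ hτ => by
    rw [hbt]
    exact ⟨a, ha, hat, hτ⟩
  have hlate : ∀ c ∈ S, a.finish I ≤ c.start → c.start < b.start →
      I.weight β c.task ≤ I.weight β b.task := fun c hc h1 h2 =>
    hP.priority c hc b hb h2 (hrel _ h1)
  by_contra hw
  rw [not_le] at hw
  have hd3 : d.start < a.finish I := by
    by_contra hcon
    exact absurd (hlate d hd (not_lt.1 hcon) hd2) (not_le.2 hw)
  -- Among the too heavy tasks started during the test of `j`, `c` is one that starts last.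
  obtain ⟨c, hc, hmax⟩ := exists_max_image (S.toFinset.filter fun c => a.start ≤ c.start ∧
    c.start < a.finish I ∧ I.weight β b.task < I.weight β c.task) (fun c => c.start)
    ⟨d, by simp only [mem_filter, List.mem_toFinset]; exact ⟨hd, hd1, hd3, hw⟩⟩
  simp only [mem_filter, List.mem_toFinset, and_imp] at hc hmax
  obtain ⟨hcS, hc1, hc2, hcw⟩ := hc
  have hbusy := hP.busy b hb (a.finish I) hwait (hrel _ le_rfl)
  choose f hfS hfm hf1 hf2 using hbusy
  -- The task `f k` busy on machine `k` when the test of `j` ends either runs already at `c.start`,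
  -- or is lighter than `c` and was not available then. In the latter case it is an execution whose
  -- test is still unfinished at `c.start`. That test has also started by then, since otherwise it
  -- would be a heavy task starting after `c`.
  have hanc : ∀ k, ∃ g ∈ S, g.start ≤ c.start ∧ c.start < g.finish I ∧
      (g = f k ∨ ∃ i, g.task = .test i ∧ (f k).task = .exec i) := fun k => by
    rcases le_or_gt (f k).start c.start with h1 | h1
    · exact ⟨f k, hfS k, h1, hc2.trans (hf2 k), Or.inl rfl⟩
    have hfw : I.weight β (f k).task ≤ I.weight β b.task := by
      rcases (hf1 k).lt_or_eq with h2 | h2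
      · by_contra hcon
        exact absurd (hmax (f k) (hfS k) (hc1.trans h1.le) h2 (not_le.1 hcon)) (not_le.2 h1)
      · exact hlate _ (hfS k) h2.ge ((hf1 k).trans_lt hwait)
    have hnot : ¬ S.Released I (f k).task c.start := fun hr => by
      have := hP.priority c hcS (f k) (hfS k) h1 hr
      linarith
    have hc0 := hF.start_nonneg c hcS
    rcases hft : (f k).task with i | i | i <;> rw [hft] at hnot
    · exact (hnot hc0).elim
    · obtain ⟨g, hg, hgt⟩ : S.Has (.test i) := by
        rcases hF.complete i with h2 | h2
        · exact (h2.2.2 ⟨_, hfS k, hft⟩).elim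
        · exact h2.2.1
      have hg1 := hF.precedence g hg (f k) (hfS k) i hgt hft
      refine ⟨g, hg, ?_, ?_, Or.inr ⟨i, hgt, rfl⟩⟩
      · by_contra hcon
        rw [not_le] at hcon
        have hgf := g.start_le_finish I
        have hgw : I.weight β c.task ≤ I.weight β g.task :=
          hP.priority c hcS g hg hcon (by rw [hgt]; exact hc0)
        rcases ((hgf.trans hg1).trans (hf1 k)).lt_or_eq with h2 | h2
        · exact absurd (hmax g hg (hc1.trans hcon.le) h2 (hcw.trans_le hgw)) (not_le.2 hcon)
        · have := hlate g hg h2.ge (h2.trans_lt hwait)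
          linarith
      · by_contra hcon
        exact hnot ⟨g, hg, hgt, not_lt.1 hcon⟩
    · exact (hnot hc0).elim
  choose g hgS hg1 hg2 hg using hanc
  -- the `m` ancestors and the test of `j` all run at the time `c.start`
  have hma : ∀ k, g k ≠ a := fun k hk => by
    rcases hg k with h1 | ⟨i, h1, h2⟩
    · have := hf2 k
      rw [← h1, hk] at this
      exact lt_irrefl _ this
    · rw [hk, hat] at h1
      obtain rfl : j = i := by injection h1
      have h3 : f k = b := hF.eq_of_task_eq (hfS k) hb (h2.trans hbt.symm)
      have := hf1 k
      rw [h3] at this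
      linarith
  have hfinj : ∀ k l, f k = f l → k = l := fun k l h => by rw [← hfm k, ← hfm l, h]
  have hginj : ∀ k l, g k = g l → k = l := fun k l h => by
    refine hfinj k l ?_
    rcases hg k with h1 | ⟨i, h1, h2⟩ <;> rcases hg l with h3 | ⟨i', h3, h4⟩
    · rw [← h1, ← h3, h]
    · have := hF.precedence (g l) (hgS l) (f l) (hfS l) i' h3 h4
      have := hf2 k
      rw [← h1, h] at this
      linarith [hf1 l]
    · have := hF.precedence (g k) (hgS k) (f k) (hfS k) i h1 h2
      have := hf2 l
      rw [← h3, ← h] at this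
      linarith [hf1 k]
    · rw [h, h3] at h1
      obtain rfl : i' = i := by injection h1
      exact hF.eq_of_task_eq (hfS k) (hfS l) (h2.trans h4.symm)
  have hinj : Function.Injective fun o : Option (Fin m) =>
      (o.elim a g).machine := fun o o' h => by
    have hrun : ∀ o : Option (Fin m), o.elim a g ∈ S ∧ (o.elim a g).start ≤ c.start ∧
        c.start < (o.elim a g).finish I := fun o => by
      cases o with
      | none => exact ⟨ha, hc1, hc2⟩
      | some k => exact ⟨hgS k, hg1 k, hg2 k⟩
    have heq := hF.eq_of_running (hrun o).1 (hrun o').1 h (hrun o).2.1 (hrun o).2.2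
      (hrun o').2.1 (hrun o').2.2
    cases o with
    | none => cases o' with
      | none => rfl
      | some k => exact (hma k heq.symm).elim
    | some k => cases o' with
      | none => exact (hma k heq).elim
      | some l => rw [hginj k l heq]
  have := Fintype.card_le_of_injective _ hinj
  simp at this

/-- If before `κ`, up to a period of length `y`, all machines are busy with other jobs than `j`,
then these jobs account for the time up to `κ`. -/
theorem Schedule.mul_le_sum_delay (S : Schedule n m) (j : Fin n) (κ x y : ℝ) (hy : 0 ≤ y)
    (h : ∀ k : Fin m, ∀ τ, 0 ≤ τ → τ < κ →
      (∃ a ∈ S, a.task.job ≠ j ∧ a.machine = k ∧ a.start ≤ τ ∧ τ < a.finish I) ∨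
        (x ≤ τ ∧ τ < x + y)) :
    m * (κ - y) ≤ ∑ i ∈ univ.erase j, S.delay I κ i := by
  unfold Schedule.delay
  rw [Schedule.sum_part, ← sum_fiberwise _ fun d : Placement n m => d.machine]
  have key : ∀ k ∈ (univ : Finset (Fin m)), κ - y ≤
      ∑ d ∈ S.toFinset.filter (fun d => d.task.job ∈ univ.erase j) with d.machine = k,
        if d.start < κ then I.duration d.task else 0 := fun k _ => by
    set Q := (S.toFinset.filter (fun d => d.task.job ∈ univ.erase j)).filter
      fun d => d.machine = k
    have h0 : ∀ d : Placement n m, 0 ≤ if d.start < κ then I.duration d.task else 0 := fun d => by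
      split_ifs
      · exact I.duration_nonneg _
      · exact le_rfl
    -- `none` stands for the exempted period `[x, x + y)`; tasks starting at `κ` or later get length
    -- 0.
    have := le_sum_of_cover (fun o : Option (Placement n m) => o.elim x Placement.start)
      (fun o => o.elim y fun d => if d.start < κ then I.duration d.task else 0)
      (insertNone Q) κ
      (fun o _ => by
        cases o with
        | none => exact hy
        | some d => exact h0 d)
      (fun τ h1 h2 => by
        rcases h k τ h1 h2 with ⟨a, ha, haj, hak, ha1, ha2⟩ | h3
        · refine ⟨some a, ?_, ha1, ?_⟩
          · simp [Q, ha, haj, hak]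
          · have : a.start < κ := ha1.trans_lt h2
            simpa [this, Placement.finish] using ha2
        · exact ⟨none, by simp, h3⟩)
    rw [sum_insertNone] at this
    simp only [Option.elim] at this
    linarith
  have := card_nsmul_le_sum _ _ _ key
  rwa [card_univ, Fintype.card_fin, nsmul_eq_mul] at this

/-- The cut is the last start for which the job had to wait: that of the untested execution, of an
execution delayed after its test, or of the test when the execution follows at once. -/
theorem Schedule.IsPCP.exists_profile (hP : S.IsPCP I Real.goldenRatio pcpBeta)
    (hF : S.IsFeasible I) (j : Fin n) :
    ∃ κ, HasProfile I S j κ ∧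
      m * (S.jobCompletion I j - S.jobTime I j) ≤ ∑ i ∈ univ.erase j, S.delay I κ i := by
  unfold Schedule.jobCompletion Schedule.jobTime
  rcases hF.part_cases j with ⟨b, hb, hbt, hp⟩ | ⟨a, ha, b, hb, hat, hbt, hab, hp⟩
  · have hb0 : ∀ τ, 0 ≤ τ → S.Released I b.task τ := fun τ h => by rw [hbt]; exact h
    refine ⟨b.start, Or.inl ⟨b, hb, hbt, hp, rfl, ?_, fun d hd h => ?_⟩, ?_⟩
    · refine I.untested_bound (not_le.1 fun h => ?_)
      rcases hF.complete j with h1 | h1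
      · exact h1.2.1 ((hP.tests j).2 h)
      · exact h1.1 ⟨b, hb, hbt⟩
    · have := hP.priority d hd b hb h (hb0 _ (hF.start_nonneg d hd))
      rwa [hbt] at this
    · have := S.mul_le_sum_delay (I := I) j b.start 0 0 le_rfl fun k τ h0 h1 => by
        obtain ⟨c, hc, hcm, hc1, hc2⟩ := hP.busy b hb τ h1 (hb0 τ h0) k
        refine Or.inl ⟨c, hc, fun hcj => ?_, hcm, hc1, hc2⟩
        have hmem : c ∈ S.part j := Schedule.mem_part.2 ⟨hc, hcj⟩
        rw [hp, mem_singleton] at hmem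
        rw [hmem] at hc1
        linarith
      simpa [hp, hbt, Placement.completion, Placement.finish] using this
  · have ha0 : ∀ τ, 0 ≤ τ → S.Released I a.task τ := fun τ h => by rw [hat]; exact h
    have hfin := hF.precedence a ha b hb j hat hbt
    have hsf := a.start_le_finish I
    have htest := I.tested_bounds ((hP.tests j).1 ⟨a, ha, hat⟩)
    have hbefore : ∀ d ∈ S, d.start < a.start →
        I.weight pcpBeta d.task ≤ pcpBeta * I.t j := fun d hd h => by
      have := hP.priority d hd a ha h (ha0 _ (hF.start_nonneg d hd))
      rwa [hat] at this
    have hjob : ∀ c ∈ S, c.task.job = j → c = a ∨ c = b := fun c hc hcj => by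
      have hmem : c ∈ S.part j := Schedule.mem_part.2 ⟨hc, hcj⟩
      simpa [hp] using hmem
    have hfa : a.finish I = a.start + I.t j := by rw [Placement.finish, hat]; rfl
    simp only [hp, sum_pair hab, hat, hbt, Placement.completion, Placement.finish,
      Instance.duration]
    rcases hfin.lt_or_eq with hwait | heq
    · refine ⟨b.start, Or.inr ⟨a, b, ha, hb, hat, hbt, hab, hp, Or.inr rfl, hsf.trans hfin,
        htest, hbefore, fun d hd h1 h2 => ?_⟩, ?_⟩
      · have := hP.weight_le_of_waiting hF ha hb hat hbt hwait hd h1 h2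
        rwa [hbt] at this
      -- The period of j's own test is exempted on all machines, because nothing forces the others
      -- to be busy then. It has length t_j, which is part of the time spent on j.
      · have := S.mul_le_sum_delay (I := I) j b.start a.start (I.t j) (I.t_nonneg j)
          fun k τ h0 h1 => by
          rcases lt_or_ge τ a.start with h2 | h2
          · obtain ⟨c, hc, hcm, hc1, hc2⟩ := hP.busy a ha τ h2 (ha0 τ h0) k
            refine Or.inl ⟨c, hc, fun hcj => ?_, hcm, hc1, hc2⟩
            rcases hjob c hc hcj with rfl | rfl <;> linarith
          · rcases lt_or_ge τ (a.finish I) with h3 | h3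
            · exact Or.inr ⟨h2, hfa ▸ h3⟩
            obtain ⟨c, hc, hcm, hc1, hc2⟩ := hP.busy b hb τ h1
              (by rw [hbt]; exact ⟨a, ha, hat, h3⟩) k
            refine Or.inl ⟨c, hc, fun hcj => ?_, hcm, hc1, hc2⟩
            rcases hjob c hc hcj with rfl | rfl <;> linarith
        convert this using 2
        ring
    · refine ⟨a.start, Or.inr ⟨a, b, ha, hb, hat, hbt, hab, hp, Or.inl rfl, hsf.trans hfin,
        htest, hbefore, fun d _ h1 h2 => absurd h1 (not_le.2 h2)⟩, ?_⟩
      have := S.mul_le_sum_delay (I := I) j a.start 0 0 le_rfl fun k τ h0 h1 => by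
        obtain ⟨c, hc, hcm, hc1, hc2⟩ := hP.busy a ha τ h1 (ha0 τ h0) k
        refine Or.inl ⟨c, hc, fun hcj => ?_, hcm, hc1, hc2⟩
        rcases hjob c hc hcj with rfl | rfl <;> linarith
      convert this using 2
      rw [← heq, hfa]
      ring

theorem HasProfile.jobTime_le {j : Fin n} {κ : ℝ} (h : HasProfile I S j κ) :
    S.jobTime I j ≤ Real.goldenRatio * I.offline j := by
  unfold Schedule.jobTime
  rcases h with ⟨b, h⟩ | ⟨a, b, h⟩
  · simpa [h.part, h.task, Instance.duration] using h.bound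
  · simpa [h.part, sum_pair h.ne, h.test, h.exec, Instance.duration] using h.bounds.2.1

/-- The cost of a schedule that follows the rule, in terms of the offline processing times. -/
theorem Schedule.IsPCP.cost_le (hP : S.IsPCP I Real.goldenRatio pcpBeta)
    (hF : S.IsFeasible I) :
    2 * m * S.cost I ≤ 2 * m * Real.goldenRatio * ∑ j, I.offline j +
      pcpBeta * (∑ i, ∑ j, min (I.offline i) (I.offline j) - ∑ j, I.offline j) := by
  choose κ hκ hC using hP.exists_profile hF
  have h1 : m * (S.cost I - ∑ j, S.jobTime I j) ≤
      ∑ j, ∑ i ∈ univ.erase j, S.delay I (κ j) i := by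
    rw [hF.cost_eq, ← sum_sub_distrib, mul_sum]
    exact sum_le_sum fun j _ => hC j
  have h2 : ∑ j, S.jobTime I j ≤ Real.goldenRatio * ∑ j, I.offline j := by
    rw [mul_sum]
    exact sum_le_sum fun j _ => (hκ j).jobTime_le
  have hswap : ∑ j, ∑ i ∈ univ.erase j, S.delay I (κ j) i =
      ∑ j, ∑ i ∈ univ.erase j, S.delay I (κ i) j := by
    refine sum_comm' fun i j => ?_
    simp [eq_comm]
  -- Adding the double sum to its transpose pairs the two mutual delays; the subtracted `∑ ρ` is the
  -- diagonal of `M`.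
  have h3 : ∑ j, ∑ i ∈ univ.erase j, S.delay I (κ j) i +
      ∑ j, ∑ i ∈ univ.erase j, S.delay I (κ i) j ≤
      pcpBeta * (∑ i, ∑ j, min (I.offline i) (I.offline j) - ∑ j, I.offline j) := by
    rw [← sum_add_distrib, ← sum_sub_distrib, mul_sum]
    refine sum_le_sum fun j _ => ?_
    have h4 : ∑ i, min (I.offline j) (I.offline i) - I.offline j =
        ∑ i ∈ univ.erase j, min (I.offline j) (I.offline i) := by
      rw [← add_sum_erase univ _ (mem_univ j), min_self]
      ring
    rw [h4, ← sum_add_distrib, mul_sum]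
    exact sum_le_sum fun i _ =>
      delay_add_delay_le (hκ j) (hκ i)
  have := mul_le_mul_of_nonneg_left h2 (Nat.cast_nonneg (α := ℝ) m)
  linarith

/-- Eliminating M between the two bounds leaves the coefficient (m − 1)(2φ − 2.31652) − 2(2.31652 −
φ) of ∑ρ. Its first part is nonnegative and is paid by ∑ρ ≤ cost; the rest is dropped. -/
theorem Schedule.IsPCP.cost_le_ratio_mul (hm : 0 < m)
    (hP : S.IsPCP I Real.goldenRatio pcpBeta) (hF : S.IsFeasible I) {T : Schedule n m}
    (hT : T.IsFeasible I) : S.cost I ≤ ratio m * T.cost I := by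
  have h1 := hP.cost_le hF
  have h2 := hT.sum_min_le_cost hm
  have h3 := hT.sum_offline_le_cost
  have hφ := goldenRatio_bounds
  have hβ := pcpBeta_bounds
  have hm1 : (1 : ℝ) ≤ m := by exact_mod_cast hm
  have hM : ∑ j, I.offline j ≤ ∑ i, ∑ j, min (I.offline i) (I.offline j) :=
    sum_le_sum fun i _ => by
      have h0 : ∀ j ∈ univ, 0 ≤ min (I.offline i) (I.offline j) := fun j _ =>
        le_min (I.offline_nonneg i) (I.offline_nonneg j)
      simpa using single_le_sum h0 (mem_univ i)
  have hρ : 0 ≤ ∑ j, I.offline j := sum_nonneg fun j _ => I.offline_nonneg j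
  generalize ∑ i, ∑ j, min (I.offline i) (I.offline j) = M at *
  generalize ∑ j, I.offline j = ρ at *
  generalize T.cost I = T at *
  generalize S.cost I = C at *
  unfold ratio
  generalize Real.goldenRatio = φ at *
  have h4 := mul_le_mul_of_nonneg_right hβ.2 (sub_nonneg.2 hM)
  have h5 : (m - 1) * (2 * φ - 2.31652) * ρ ≤ (m - 1) * (2 * φ - 2.31652) * T :=
    mul_le_mul_of_nonneg_left h3 (mul_nonneg (by linarith) (by linarith))
  have h6 : 0 ≤ (2.31652 - φ) * ρ := mul_nonneg (by linarith) hρ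
  have h7 : 2 * m * C ≤ 2 * m * ((2.31652 * (1 / 2 + 1 / (2 * (m : ℝ))) + φ * (1 - 1 / m)) * T) := by
    have e : 2 * m * ((2.31652 * (1 / 2 + 1 / (2 * (m : ℝ))) + φ * (1 - 1 / m)) * T) =
        (2.31652 * (m + 1) + 2 * φ * (m - 1)) * T := by
      field_simp
    rw [e]
    linarith
  exact le_of_mul_le_mul_left h7 (by positivity)

end

end

/-! ### Construction of the list schedule: definitions. -/

section

open scoped Classical

section

variable {n m : ℕ}

instance (n : ℕ) : Finite (Task n) :=
  Finite.of_injective (β := Fin n × Fin 3)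
    (fun x => match x with
      | .test j => (j, 0)
      | .exec j => (j, 1)
      | .untested j => (j, 2))
    (fun x y h => by cases x <;> cases y <;> simp_all)

/-- Whether the rule asks for the task `x` once the decisions in `S` have been taken. -/
def Allowed (I : Instance n) (α : ℝ) (S : Schedule n m) : Task n → Prop
  | .test j => α * I.t j ≤ I.u j
  | .exec j => S.Has (.test j)
  | .untested j => I.u j < α * I.t j

/-- The task `x` still has to be started after the decisions in `S`. -/
def Pending (I : Instance n) (α : ℝ) (S : Schedule n m) (x : Task n) : Prop :=
  ¬ S.Has x ∧ Allowed I α S x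

/-- The placement `d` can be added to the decisions in `S`. -/
structure Candidate (I : Instance n) (α : ℝ) (S : Schedule n m) (d : Placement n m) : Prop where
  pending : Pending I α S d.task
  nonneg : 0 ≤ d.start
  free : ∀ a ∈ S, a.machine = d.machine → a.finish I ≤ d.start
  after : ∀ a ∈ S, ∀ j, a.task = .test j → d.task = .exec j → a.finish I ≤ d.start

/-- Among the placements that can be added to `S`, `d` starts first and, subject to this, has the
smallest weight. -/
def IsNext (I : Instance n) (α β : ℝ) (S : Schedule n m) (d : Placement n m) : Prop :=
  Candidate I α S d ∧ ∀ e, Candidate I α S e → d.start ≤ e.start ∧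
    (e.start = d.start → I.weight β d.task ≤ I.weight β e.task)

/-- The next decision. -/
noncomputable def next (I : Instance n) (α β : ℝ) (S : Schedule n m) : Option (Placement n m) :=
  if h : ∃ d, IsNext I α β S d then some h.choose else none

/-- The first `k` decisions. -/
noncomputable def decisions (m : ℕ) (I : Instance n) (α β : ℝ) : ℕ → Schedule n m
  | 0 => []
  | k + 1 => decisions m I α β k ++ (next I α β (decisions m I α β k)).toList

/-- The list schedule produced by the rule. -/
noncomputable def listSchedule (m : ℕ) (I : Instance n) (α β : ℝ) : Schedule n m :=
  decisions m I α β (Nat.card (Task n) + 1)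

/-- The properties of the list of the first decisions. -/
structure Invariant (I : Instance n) (α β : ℝ) (S : Schedule n m) : Prop where
  start_nonneg : ∀ d ∈ S, 0 ≤ d.start
  nodup : (S.map Placement.task).Nodup
  allowed : ∀ d ∈ S, Allowed I α S d.task
  precedence : ∀ a ∈ S, ∀ b ∈ S, ∀ j : Fin n,
    a.task = .test j → b.task = .exec j → a.finish I ≤ b.start
  machine : ∀ a ∈ S, ∀ b ∈ S, a.task ≠ b.task → a.machine = b.machine →
    a.finish I ≤ b.start ∨ b.finish I ≤ a.start
  sorted : S.Pairwise fun a b => a.start ≤ b.start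
  -- This field and the two `pending_` fields concern tasks not yet started; they yield `sorted`,
  -- `priority` and `busy` once such a task is appended.
  last : ∀ a ∈ S, ∀ d, Candidate I α S d → a.start ≤ d.start
  priority : ∀ a ∈ S, ∀ b ∈ S, a.start < b.start → S.Released I b.task a.start →
    I.weight β a.task ≤ I.weight β b.task
  pending_priority : ∀ a ∈ S, ∀ x, Pending I α S x → S.Released I x a.start →
    I.weight β a.task ≤ I.weight β x
  busy : ∀ b ∈ S, ∀ τ : ℝ, τ < b.start → S.Released I b.task τ →
    ∀ i : Fin m, ∃ a ∈ S, a.machine = i ∧ a.start ≤ τ ∧ τ < a.finish I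
  pending_busy : ∀ x, Pending I α S x → ∀ τ : ℝ, S.Released I x τ → ∀ b ∈ S, τ < b.start →
    ∀ i : Fin m, ∃ a ∈ S, a.machine = i ∧ a.start ≤ τ ∧ τ < a.finish I

end

/-! ### The invariant is preserved by each decision. -/

section

variable {n m : ℕ} {I : Instance n} {α β : ℝ} {S : Schedule n m} {d : Placement n m}

theorem Schedule.has_append {x : Task n} :
    Schedule.Has (S ++ [d]) x ↔ S.Has x ∨ d.task = x := by
  simp [Schedule.Has, or_and_right, exists_or]

theorem Schedule.released_append {x : Task n} {τ : ℝ} :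
    Schedule.Released I (S ++ [d]) x τ ↔
      S.Released I x τ ∨ ∃ j, x = .exec j ∧ d.task = .test j ∧ d.finish I ≤ τ := by
  cases x <;> simp [Schedule.Released, or_and_right, exists_or]

theorem Allowed.mono {x : Task n} (h : Allowed I α S x) : Allowed I α (S ++ [d]) x := by
  cases x with
  | exec j => exact Schedule.has_append.2 (Or.inl h)
  | _ => exact h

theorem Pending.of_append {x : Task n} (h : Pending I α (S ++ [d]) x) :
    Pending I α S x ∨ ∃ j, x = .exec j ∧ d.task = .test j := by
  obtain ⟨h1, h2⟩ := h
  rw [Schedule.has_append, not_or] at h1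
  cases x with
  | exec j => exact (Schedule.has_append.1 h2).imp (fun h => ⟨h1.1, h⟩) fun h => ⟨j, rfl, h⟩
  | _ => exact Or.inl ⟨h1.1, h2⟩

/-- A task released after the decisions in `S` that is pending one decision later was pending. -/
theorem Pending.of_append_of_released {x : Task n} {τ : ℝ} (h : Pending I α (S ++ [d]) x)
    (hd : ¬ S.Has d.task) (hr : S.Released I x τ) : Pending I α S x := by
  rcases h.of_append with h1 | ⟨j, rfl, h2⟩
  · exact h1
  · obtain ⟨a, ha, hat, -⟩ := hr
    exact (hd ⟨a, ha, hat.trans h2.symm⟩).elim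

theorem Invariant.candidate (h : Invariant I α β S) {x : Task n} {τ : ℝ} {i : Fin m}
    (hx : Pending I α S x) (hr : S.Released I x τ)
    (hfree : ∀ a ∈ S, a.machine = i → a.finish I ≤ τ) : Candidate I α S ⟨x, i, τ⟩ := by
  refine ⟨hx, ?_, hfree, ?_⟩
  · cases x with
    | exec j =>
      obtain ⟨a, ha, -, h1⟩ := hr
      exact (h.start_nonneg a ha).trans ((a.start_le_finish I).trans h1)
    | _ => exact hr
  · rintro a ha j hat rfl
    obtain ⟨c, hc, hct, h1⟩ := hr
    rwa [List.inj_on_of_nodup_map h.nodup ha hc (hat.trans hct.symm)]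

/-- If no task on machine `i` ended after `τ`, then `x` could start there at `τ`, before `d`. If one
ends after `τ` but also starts after it, the invariant already applies. -/
theorem Invariant.busy_of_lt_next (h : Invariant I α β S) (hd : IsNext I α β S d) {x : Task n}
    {τ : ℝ} (hx : Pending I α S x) (hr : S.Released I x τ) (hτ : τ < d.start) (i : Fin m) :
    ∃ a ∈ S, a.machine = i ∧ a.start ≤ τ ∧ τ < a.finish I := by
  obtain ⟨a, ha, hai, h1⟩ : ∃ a ∈ S, a.machine = i ∧ τ < a.finish I := by
    by_contra! hcon
    exact absurd (hd.2 _ (h.candidate hx hr hcon)).1 (not_le.2 hτ)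
  rcases le_or_gt a.start τ with h2 | h2
  · exact ⟨a, ha, hai, h2, h1⟩
  · exact h.pending_busy x hx τ hr a ha h2 i

theorem Invariant.not_test_of_exec (h : Invariant I α β S) {b : Placement n m} {j : Fin n}
    (hd : ¬ S.Has d.task) (hb : b ∈ S) (hbt : b.task = .exec j) : d.task ≠ .test j := fun hdt => by
  have := h.allowed b hb
  rw [hbt] at this
  exact hd (hdt ▸ this)

/-- For tests of length 0: the execution is then available at the very start of its test, so it must
also be compared with tasks chosen earlier at that same instant. They were compared with the test.
-/
theorem weight_test_le_exec {j : Fin n} (ht : I.t j ≤ 0) :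
    I.weight β (.test j) ≤ I.weight β (.exec j) := by
  have h0 : I.t j = 0 := le_antisymm ht (I.t_nonneg j)
  simp [Instance.weight, h0, I.p_nonneg j]

theorem exists_append_busy {τ : ℝ} {i : Fin m}
    (h : ∃ a ∈ S, a.machine = i ∧ a.start ≤ τ ∧ τ < a.finish I) :
    ∃ a ∈ S ++ [d], a.machine = i ∧ a.start ≤ τ ∧ τ < a.finish I :=
  h.imp fun _ h => ⟨List.mem_append_left _ h.1, h.2⟩

theorem Invariant.nil : Invariant I α β ([] : Schedule n m) := by
  constructor <;> simp

theorem Invariant.append (h : Invariant I α β S) (hd : IsNext I α β S d) :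
    Invariant I α β (S ++ [d]) := by
  have hfresh := hd.1.pending.1
  have hle : ∀ a ∈ S, a.start ≤ d.start := fun a ha => h.last a ha d hd.1
  have hmem : ∀ {a : Placement n m}, a ∈ S ++ [d] → a ∈ S ∨ a = d := fun {a} ha => by
    simpa using ha
  have hexec : ∀ {j}, d.finish I ≤ d.start → d.task = .test j → I.t j ≤ 0 := fun {j} h1 h2 => by
    rw [Placement.finish, h2] at h1
    exact (add_le_iff_nonpos_right _).1 h1
  have hnew : ∀ b ∈ S, ∀ τ, Schedule.Released I (S ++ [d]) b.task τ →
      S.Released I b.task τ := fun b hb τ hr => by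
    rcases Schedule.released_append.1 hr with h1 | ⟨j, h1, h2, -⟩
    · exact h1
    · exact (h.not_test_of_exec hfresh hb h1 h2).elim
  have hself : ∀ τ, Schedule.Released I (S ++ [d]) d.task τ → S.Released I d.task τ :=
      fun τ hr => by
    rcases Schedule.released_append.1 hr with h1 | ⟨j, h1, h2, -⟩
    · exact h1
    · rw [h1] at h2
      cases h2
  constructor
  · intro a ha
    rcases hmem ha with ha | rfl
    · exact h.start_nonneg a ha
    · exact hd.1.nonneg
  · rw [List.map_append, List.nodup_append]
    refine ⟨h.nodup, by simp, ?_⟩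
    rintro x hx y hy rfl
    obtain ⟨a, ha, hax⟩ := List.mem_map.1 hx
    simp only [List.map_cons, List.map_nil, List.mem_singleton] at hy
    exact hfresh ⟨a, ha, hax.trans hy⟩
  · intro a ha
    rcases hmem ha with ha | rfl
    · exact (h.allowed a ha).mono
    · exact hd.1.pending.2.mono
  · intro a ha b hb j hat hbt
    rcases hmem ha with haS | rfl <;> rcases hmem hb with hbS | rfl
    · exact h.precedence a haS b hbS j hat hbt
    · exact hd.1.after a haS j hat hbt
    · exact (h.not_test_of_exec hfresh hbS hbt hat).elim
    · rw [hat] at hbt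
      cases hbt
  · intro a ha b hb hne hm
    rcases hmem ha with haS | rfl <;> rcases hmem hb with hbS | rfl
    · exact h.machine a haS b hbS hne hm
    · exact Or.inl (hd.1.free a haS hm)
    · exact Or.inr (hd.1.free b hbS hm.symm)
    · exact (hne rfl).elim
  · rw [List.pairwise_append]
    refine ⟨h.sorted, by simp, fun a ha b hb => ?_⟩
    rw [List.mem_singleton.1 hb]
    exact hle a ha
  · intro a ha e he
    have hde : d.start ≤ e.start := by
      rcases he.pending.of_append with h1 | ⟨j, h1, h2⟩
      · exact (hd.2 e ⟨h1, he.nonneg, fun c hc => he.free c (List.mem_append_left _ hc),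
          fun c hc => he.after c (List.mem_append_left _ hc)⟩).1
      · exact (d.start_le_finish I).trans (he.after d (by simp) j h2 h1)
    rcases hmem ha with ha | rfl
    · exact (hle a ha).trans hde
    · exact hde
  · intro a ha b hb hab hr
    rcases hmem ha with haS | rfl <;> rcases hmem hb with hbS | rfl
    · exact h.priority a haS b hbS hab (hnew b hbS _ hr)
    · exact h.pending_priority a haS _ hd.1.pending (hself _ hr)
    · exact absurd (hle b hbS) (not_le.2 hab)
    · exact (lt_irrefl _ hab).elim
  · intro a ha x hx hr
    rcases Schedule.released_append.1 hr with h1 | ⟨j, rfl, h2, h3⟩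
    · have hxS := hx.of_append_of_released hfresh h1
      rcases hmem ha with ha | rfl
      · exact h.pending_priority a ha x hxS h1
      · exact (hd.2 _ (h.candidate hxS h1 hd.1.free)).2 rfl
    · rcases hmem ha with ha | rfl
      · have ht := hexec (h3.trans (hle a ha)) h2
        refine le_trans ?_ (weight_test_le_exec ht)
        have hp := hd.1.pending
        rw [h2] at hp
        exact h.pending_priority a ha _ hp (h.start_nonneg a ha)
      · rw [h2]
        exact weight_test_le_exec (hexec h3 h2)
  · intro b hb τ hτ hr i
    rcases hmem hb with hb | rfl
    · exact exists_append_busy (h.busy b hb τ hτ (hnew b hb _ hr) i)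
    · exact exists_append_busy (h.busy_of_lt_next hd hd.1.pending (hself _ hr) hτ i)
  · intro x hx τ hr b hb hτ i
    have hτd : τ < d.start := by
      rcases hmem hb with hb | rfl
      · exact hτ.trans_le (hle b hb)
      · exact hτ
    rcases Schedule.released_append.1 hr with h1 | ⟨j, -, -, h3⟩
    · exact exists_append_busy
        (h.busy_of_lt_next hd (hx.of_append_of_released hfresh h1) h1 hτd i)
    · linarith [d.start_le_finish I]

/-- The earliest start of a pending task on a machine. -/
theorem Pending.exists_earliest {x : Task n} (hx : Pending I α S x) (i : Fin m) :
    ∃ s, Candidate I α S ⟨x, i, s⟩ ∧ ∀ s', Candidate I α S ⟨x, i, s'⟩ → s ≤ s' := by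
  set T : Finset ℝ := insert 0 (((S.filter fun a => a.machine = i ∨
    ∃ j, a.task = .test j ∧ x = .exec j).map (Placement.finish I)).toFinset) with hT
  have hne : T.Nonempty := ⟨0, Finset.mem_insert_self _ _⟩
  have hmem : ∀ a ∈ S, (a.machine = i ∨ ∃ j, a.task = .test j ∧ x = .exec j) →
      a.finish I ∈ T := fun a ha h => by
    refine Finset.mem_insert_of_mem (List.mem_toFinset.2 (List.mem_map.2 ⟨a, ?_, rfl⟩))
    exact List.mem_filter.2 ⟨ha, decide_eq_true h⟩
  refine ⟨T.max' hne, ⟨hx, T.le_max' _ (Finset.mem_insert_self _ _),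
    fun a ha h => T.le_max' _ (hmem a ha (Or.inl h)),
    fun a ha j h1 h2 => T.le_max' _ (hmem a ha (Or.inr ⟨j, h1, h2⟩))⟩, fun s' h => ?_⟩
  refine Finset.max'_le _ _ _ fun y hy => ?_
  rcases Finset.mem_insert.1 hy with rfl | hy
  · exact h.nonneg
  · obtain ⟨a, ha, rfl⟩ := List.mem_map.1 (List.mem_toFinset.1 hy)
    obtain ⟨haS, ha⟩ := List.mem_filter.1 ha
    rcases of_decide_eq_true ha with h1 | ⟨j, h1, h2⟩
    · exact h.free a haS h1
    · exact h.after a haS j h1 h2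

/-- A lexicographic minimum of earliest start and weight over the finitely many pairs of a pending
task and a machine. -/
theorem Pending.exists_next {x : Task n} (hx : Pending I α S x) (hm : 0 < m) :
    ∃ d, IsNext I α β S d := by
  choose s hs hmin using fun p : {x : Task n // Pending I α S x} × Fin m =>
    p.1.2.exists_earliest p.2
  have : Nonempty ({x : Task n // Pending I α S x} × Fin m) := ⟨⟨x, hx⟩, ⟨0, hm⟩⟩
  obtain ⟨p, hp⟩ := Finite.exists_min fun p : {x : Task n // Pending I α S x} × Fin m =>
    toLex (s p, I.weight β p.1.1)
  refine ⟨_, hs p, fun e he => ?_⟩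
  have h1 := hmin (⟨e.task, he.pending⟩, e.machine) e.start he
  have h2 := Prod.Lex.toLex_le_toLex.1 (hp (⟨e.task, he.pending⟩, e.machine))
  dsimp only at h1 h2 ⊢
  rcases h2 with h2 | ⟨h2, h3⟩
  · exact ⟨h2.le.trans h1, fun h => by linarith⟩
  · exact ⟨h2.le.trans h1, fun _ => h3⟩

theorem isNext_of_next_eq (h : next I α β S = some d) : IsNext I α β S d := by
  unfold next at h
  split_ifs at h with h1
  obtain rfl := Option.some.inj h
  exact h1.choose_spec

theorem not_isNext_of_next_eq_none (h : next I α β S = none) (d : Placement n m) :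
    ¬ IsNext I α β S d := fun hd => by
  unfold next at h
  rw [dif_pos ⟨d, hd⟩] at h
  cases h

end

/-! ### Termination, feasibility and the list scheduling rule. -/

section

variable {n : ℕ} (m : ℕ) (I : Instance n) (α β : ℝ)

theorem invariant_decisions (k : ℕ) : Invariant I α β (decisions m I α β k) := by
  induction k with
  | zero => exact Invariant.nil
  | succ k ih =>
    rw [decisions]
    rcases h : next I α β (decisions m I α β k) with _ | d
    · simpa using ih
    · exact ih.append (isNext_of_next_eq h)

theorem decisions_prefix {k l : ℕ} (h : k ≤ l) : decisions m I α β k <+: decisions m I α β l := by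
  induction l, h using Nat.le_induction with
  | base => exact List.prefix_rfl
  | succ l _ ih => exact ih.trans (List.prefix_append _ _)

theorem decisions_eq_of_next_eq_none {k l : ℕ} (h : k ≤ l)
    (hn : next I α β (decisions m I α β k) = none) :
    decisions m I α β l = decisions m I α β k := by
  induction l, h using Nat.le_induction with
  | base => rfl
  | succ l _ ih => rw [decisions, ih, hn, Option.toList_none, List.append_nil]

theorem length_decisions (k : ℕ) : (decisions m I α β k).length = k ∨
    (decisions m I α β k).length < k ∧ next I α β (decisions m I α β k) = none := by
  induction k with
  | zero => exact Or.inl rfl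
  | succ k ih =>
    rcases h : next I α β (decisions m I α β k) with _ | d
    · rw [decisions_eq_of_next_eq_none m I α β k.le_succ h]
      exact Or.inr ⟨by rcases ih with h1 | h1 <;> omega, h⟩
    · rcases ih with h1 | h1
      · left
        rw [decisions, h]
        simp [h1]
      · rw [h1.2] at h
        cases h

/-- No task is repeated, so among one more step than there are tasks some step must find nothing to
do. -/
theorem next_listSchedule : next I α β (listSchedule m I α β) = none := by
  rcases length_decisions m I α β (Nat.card (Task n) + 1) with h | h
  · have := Fintype.ofFinite (Task n)
    have h1 := (invariant_decisions m I α β (Nat.card (Task n) + 1)).nodup.length_le_card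
    rw [List.length_map, h, Nat.card_eq_fintype_card] at h1
    omega
  · exact h.2

variable {m}

theorem not_pending_listSchedule (hm : 0 < m) (x : Task n) :
    ¬ Pending I α (listSchedule m I α β) x := fun hx => by
  obtain ⟨d, hd⟩ := hx.exists_next (β := β) hm
  exact not_isNext_of_next_eq_none (next_listSchedule m I α β) d hd

theorem listSchedule_tests (hm : 0 < m) (j : Fin n) :
    (listSchedule m I α β).Has (.test j) ↔ α * I.t j ≤ I.u j := by
  refine ⟨fun ⟨d, hd, hdt⟩ => ?_, fun h => ?_⟩
  · have := (invariant_decisions m I α β _).allowed d hd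
    rwa [hdt] at this
  · by_contra hcon
    exact not_pending_listSchedule I α β hm (.test j) ⟨hcon, h⟩

theorem listSchedule_isFeasible (hm : 0 < m) : (listSchedule m I α β).IsFeasible I := by
  have h : Invariant I α β (listSchedule m I α β) := invariant_decisions m I α β _
  refine ⟨h.start_nonneg, h.nodup, fun j => ?_, h.precedence, h.machine⟩
  have htest := listSchedule_tests I α β hm j
  have hexec : (listSchedule m I α β).Has (.exec j) ↔ (listSchedule m I α β).Has (.test j) := by
    refine ⟨fun ⟨d, hd, hdt⟩ => ?_, fun h1 => ?_⟩
    · have := h.allowed d hd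
      rwa [hdt] at this
    · by_contra hcon
      exact not_pending_listSchedule I α β hm (.exec j) ⟨hcon, h1⟩
  have hunt : (listSchedule m I α β).Has (.untested j) ↔ I.u j < α * I.t j := by
    refine ⟨fun ⟨d, hd, hdt⟩ => ?_, fun h1 => ?_⟩
    · have := h.allowed d hd
      rwa [hdt] at this
    · by_contra hcon
      exact not_pending_listSchedule I α β hm (.untested j) ⟨hcon, h1⟩
  rw [hexec, htest, hunt, ← not_le]
  tauto

theorem listSchedule_isPCP (hm : 0 < m) : (listSchedule m I α β).IsPCP I α β := by
  have h : Invariant I α β (listSchedule m I α β) := invariant_decisions m I α β _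
  exact ⟨listSchedule_tests I α β hm, h.priority, h.busy⟩

end

/-! ### Causality. -/

section

variable {n m : ℕ} {I J : Instance n} {α β : ℝ} {S : Schedule n m} {d : Placement n m}

theorem Candidate.congr (ht : I.t = J.t) (hu : I.u = J.u)
    (hfin : ∀ a ∈ S, a.finish I = a.finish J) (h : Candidate I α S d) : Candidate J α S d := by
  refine ⟨⟨h.pending.1, ?_⟩, h.nonneg, fun a ha => hfin a ha ▸ h.free a ha,
    fun a ha => hfin a ha ▸ h.after a ha⟩
  have := h.pending.2
  cases hx : d.task <;> rw [hx] at this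
  · simpa [Allowed, ht, hu] using this
  · exact this
  · simpa [Allowed, ht, hu] using this

/-- The next decision depends only on what is known when it is taken. -/
theorem next_congr (hS : Invariant I α β S) (hd : IsNext I α β S d) (ht : I.t = J.t)
    (hu : I.u = J.u) (hp : ∀ a ∈ S, ∀ j, a.task = .test j → a.finish I ≤ d.start →
      I.p j = J.p j) : next I α β S = next J α β S := by
  have hknown : ∀ j, ∀ τ ≤ d.start, S.Released I (.exec j) τ → I.p j = J.p j := by
    rintro j τ hτ ⟨a, ha, hat, h1⟩
    exact hp a ha j hat (h1.trans hτ)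
  have hfin : ∀ a ∈ S, a.finish I = a.finish J := fun a ha => by
    unfold Placement.finish
    congr 1
    rcases hat : a.task with j | j | j
    · exact congr_fun ht j
    · obtain ⟨c, hc, hct⟩ : S.Has (.test j) := by
        have := hS.allowed a ha
        rwa [hat] at this
      exact hknown j a.start (hS.last a ha d hd.1)
        ⟨c, hc, hct, hS.precedence c hc a ha j hct hat⟩
    · exact congr_fun hu j
  have hC : ∀ e, Candidate I α S e ↔ Candidate J α S e := fun e =>
    ⟨fun h => h.congr ht hu hfin, fun h => h.congr ht.symm hu.symm fun a ha => (hfin a ha).symm⟩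
  -- Weights matter only among candidates starting together with `d`; an execution among them has
  -- its test finished by then, so its weight is known.
  have hW : ∀ e, Candidate I α S e → e.start = d.start →
      I.weight β e.task = J.weight β e.task := fun e he hed => by
    rcases hat : e.task with j | j | j
    · simp [Instance.weight, ht]
    · obtain ⟨c, hc, hct⟩ : S.Has (.test j) := by
        have := he.pending.2
        rwa [hat] at this
      have := hknown j e.start hed.le ⟨c, hc, hct, he.after c hc j hct hat⟩
      simp [Instance.weight, ht, this]
    · simp [Instance.weight, hu]
  -- `next` picks by choice among ties (machines, for instance), so the predicates must be equal for
  -- the picks to coincide.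
  have key : IsNext I α β S = IsNext J α β S := by
    funext e
    refine propext ⟨fun he => ⟨(hC e).1 he.1, fun f hf => ?_⟩,
      fun he => ⟨(hC e).2 he.1, fun f hf => ?_⟩⟩
    · have hed : e.start = d.start := le_antisymm (he.2 d hd.1).1 (hd.2 e he.1).1
      have h1 := he.2 f ((hC f).2 hf)
      refine ⟨h1.1, fun hfe => ?_⟩
      rw [← hW e he.1 hed, ← hW f ((hC f).2 hf) (hfe.trans hed)]
      exact h1.2 hfe
    · have heI := (hC e).2 he.1
      have hed : e.start = d.start :=
        le_antisymm (he.2 d ((hC d).1 hd.1)).1 (hd.2 e heI).1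
      have h1 := he.2 f ((hC f).1 hf)
      refine ⟨h1.1, fun hfe => ?_⟩
      rw [hW e heI hed, hW f hf (hfe.trans hed)]
      exact h1.2 hfe
  unfold next
  simp only [key]

theorem listSchedule_causal (ht : I.t = J.t) (hu : I.u = J.u) (k : ℕ)
    (hk : k < (listSchedule m I α β).length)
    (hp : ∀ d ∈ (listSchedule m I α β).take k, ∀ j : Fin n, d.task = .test j →
      d.finish I ≤ (listSchedule m I α β)[k].start → I.p j = J.p j) :
    (listSchedule m I α β).take (k + 1) <+: listSchedule m J α β := by
  have hN : k < Nat.card (Task n) + 1 := by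
    rcases length_decisions m I α β (Nat.card (Task n) + 1) with h | h <;>
      unfold listSchedule at hk <;> omega
  have hlen : ∀ l ≤ k + 1, (decisions m I α β l).length = l := fun l hl => by
    rcases length_decisions m I α β l with h | h
    · exact h
    · have := decisions_eq_of_next_eq_none m I α β (hl.trans hN) h.2
      rw [listSchedule, this] at hk
      omega
  have hpre : ∀ l ≤ k + 1, decisions m I α β l = (listSchedule m I α β).take l := fun l hl => by
    have h1 := List.prefix_iff_eq_take.1 (decisions_prefix m I α β (hl.trans hN))
    rwa [hlen l hl] at h1
  have hsorted := (invariant_decisions m I α β (Nat.card (Task n) + 1)).sorted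
  have heq : ∀ l ≤ k + 1, decisions m I α β l = decisions m J α β l := fun l => by
    induction l with
    | zero => exact fun _ => rfl
    | succ l ih =>
      intro hl
      have ih := ih (by omega)
      rw [decisions, decisions, ← ih]
      rcases hn : next I α β (decisions m I α β l) with _ | d
      · have h1 := hlen (l + 1) hl
        rw [decisions_eq_of_next_eq_none m I α β l.le_succ hn, hlen l (by omega)] at h1
        omega
      · have hdl : (listSchedule m I α β)[l] = d := by
          have h1 := hpre (l + 1) hl
          rw [decisions, hn, List.take_add_one, ← hpre l (by omega),
            List.append_cancel_left_eq, List.getElem?_eq_getElem (by omega)] at h1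
          simpa using h1.symm
        -- Decisions are sorted by start, so whatever is known at decision `l` is covered by the
        -- hypothesis for decision `k`.
        have hdk : d.start ≤ (listSchedule m I α β)[k].start := by
          rcases (show l ≤ k by omega).eq_or_lt with rfl | hlk
          · rw [hdl]
          · rw [← hdl]
            exact List.pairwise_iff_getElem.1 hsorted l k (by unfold listSchedule at hk; omega)
              hk hlk
        rw [← hn]
        congr 2
        refine next_congr (invariant_decisions m I α β l) (isNext_of_next_eq hn) ht hu ?_
        intro a ha j hat haf
        rw [hpre l (by omega)] at ha
        exact hp a (List.take_subset_take_left _ (by omega) ha) j hat (haf.trans hdk)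
  rw [← hpre (k + 1) le_rfl, heq (k + 1) le_rfl]
  exact decisions_prefix m J α β hN

end

/-- The list schedules of the rule, as an online algorithm. -/
noncomputable def pcpAlgorithm {m : ℕ} (hm : 0 < m) (α β : ℝ) : OnlineAlgorithm m where
  run I := listSchedule m I α β
  feasible I := listSchedule_isFeasible I α β hm
  chronological I := (invariant_decisions m I α β _).sorted
  causal _ _ ht hu k hk hp := listSchedule_causal ht hu k hk hp

end

end SEU

theorem mainTheorem5 :
    (∀ m : ℕ, 0 < m → ∃ A : SEU.OnlineAlgorithm m,
      (∀ (n : ℕ) (I : SEU.Instance n),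
        (A.run I).IsPCP I Real.goldenRatio SEU.pcpBeta) ∧
      A.IsCompetitive (SEU.ratio m)) ∧
    Filter.Tendsto SEU.ratio Filter.atTop (nhds (2.31652 / 2 + Real.goldenRatio)) ∧
    (2.77629 : ℝ) < 2.31652 / 2 + Real.goldenRatio ∧
    2.31652 / 2 + Real.goldenRatio < (2.77630 : ℝ) := by
  have h := SEU.goldenRatio_bounds
  refine ⟨fun m hm => ⟨SEU.pcpAlgorithm hm Real.goldenRatio SEU.pcpBeta,
    fun n I => SEU.listSchedule_isPCP I _ _ hm, fun n I S hS => ?_⟩, SEU.tendsto_ratio,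
    by linarith, by linarith⟩
  exact (SEU.listSchedule_isPCP I _ _ hm).cost_le_ratio_mul hm
    (SEU.listSchedule_isFeasible I _ _ hm) hS
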